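/- **Setting.** Let $m\ge 1$ and let $\mathscr A_m$ be the real Clifford algebra generated by $e_1,\dots,e_m$ with $e_ie_j+e_je_i=-2\delta_{ij}$. Write $x=\sum_T x_Te_T$ ($T\subseteq\{1,\dots,m\}$), $|x|=(\sum_T x_T^2)^{1/2}$, and let $\overline{x}$ be the conjugation, i.e. the linear map with $\overline{xy}=\overline y\,\overline x$, $\overline{1}=1$, $\overline{e_i}=-e_i$. Identify $\mathbb R^{m+1}$ with $\{x_0+x_1e_1+\dots+x_me_m\}\subset\mathscr A_m$; let $B^{m+1}$ be its open unit ball, $S^m$ its unit sphere, $dS$ the surface measure and $\omega_m$ the area of $S^m$. The monogenic Hardy space $\mathcal H^2(B^{m+1})$ consists of the left monogenic functions $f:B^{m+1}\to\mathscr A_m$ (of class $C^1$ with $\sum_{i=0}^m e_i\,\partial f/\partial x_i=0$, $e_0=1$) with $$\|f\|:=\sup_{0<r<1}\Big(\frac1{\omega_m}\int_{S^m}|f(r\eta)|^2\,dS(\eta)\Big)^{1/2}<\infty ,$$ and has the $\mathscr A_m$-valued inner product $\langle f,g\rangle=\lim_{r\to1^-}\frac1{\omega_m}\int_{S^m}\overline{g(r\eta)}f(r\eta)\,dS(\eta)$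 (equivalently, the integral of $\overline g f$ for the boundary values on $S^m$). For $a\in B^{m+1}$ let $$S_a(x)=\frac{\overline{1-\overline a x}}{|1-\overline a x|^{m+1}},\qquad B_a=\frac{S_a}{\|S_a\|}.$$ For $M\in\mathbb R$, let $\mathcal H^2(B^{m+1},M)$ be the set of all $f\in\mathcal H^2(B^{m+1})$ of the form $f=\sum_{k=1}^\infty B_{b_k}c_k$ (convergence in $\mathcal H^2(B^{m+1})$) with $b_k\in B^{m+1}$, $c_k\in\mathscr A_m$ and $\sum_{k=1}^\infty|c_k|\le M$. **Takenaka–Malmquist systems.** For $f,G\in\mathcal H^2(B^{m+1})$ put $P_Gf:=G\,\langle G,G\rangle^{-1}\langle f,G\rangle$ (an inverse that does not exist is read as $0$). Given $a_1,\dots,a_{n-1}\in B^{m+1}$ and functions $B_i=B_{a_1,\dots,a_i}$ ($i<n$), define for $b\in B^{m+1}$: if $b\notin\{a_1,\dots,a_{n-1}\}$, $$B_{a_1,\dots,a_{n-1},b}=\frac{T}{\|T\|},\qquad T=S_b-\sum_{i=1}^{n-1}P_{B_i}S_b ;$$ if $b\in\{a_1,\dots,a_{n-1}\}$, $B_{a_1,\dots,a_{n-1},b}$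 denotes, for a chosen unit vector $\omega\in S^m$, the limit in $\mathcal H^2(B^{m+1})$ of $B_{a_1,\dots,a_{n-1},b+\rho\omega}$ as $\rho\to0^+$. **Adaptive approximation.** Let $f\in\mathcal H^2(B^{m+1})$. A sequence $a_1,a_2,\dots\in B^{m+1}$ (with directions $\omega_n\in S^m$, relevant only for repeated parameters) and the resulting functions $B_n=B_{a_1,\dots,a_n}$ are selected by the maximum selection principle if for every $n\ge1$ $$\|P_{B_n}f\|=\max_{b}\ \|P_{B_{a_1,\dots,a_{n-1},b}}f\| ,$$ the maximum being over all $b\in B^{m+1}$ (and, for repeated $b$, all directions). The residue at the $N$-th step is $f_N=f-\sum_{i=1}^{N-1}P_{B_i}f$, so that $f_1=f$. **Theorem 5.3 (convergence rate).** Let $f\in\mathcal H^2(B^{m+1},M)$. Then, for every choice of parameters (and directions) for $f$ by the maximum selection principle and every $N\ge1$, $$\|f_N\|\le\frac{2^{m/2}M}{\sqrt N}.$$ -/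

import Mathlib

open MeasureTheory Filter Topology

noncomputable section

namespace CliffordTM

/-- The sign in `e_A e_B = (-1)^{#(A ∩ B)} (-1)^{p(A,B)} e_{A ∆ B}`, where
`p(A,B) = ∑_{j ∈ B} #{i ∈ A : i > j}`. -/
def sgn {m : ℕ} (A B : Finset (Fin m)) : ℝ :=
  (-1) ^ (A ∩ B).card * (-1) ^ (∑ j ∈ B, (A.filter (fun i => j < i)).card)

theorem sgn_eq_prod {m : ℕ} (A B : Finset (Fin m)) :
    sgn A B = ∏ i ∈ A, ∏ j ∈ B, (if j ≤ i then (-1 : ℝ) else 1) := by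
  have h1 : ((-1 : ℝ)) ^ (A ∩ B).card = ∏ j ∈ B, (if j ∈ A then (-1 : ℝ) else 1) := by
    rw [Finset.prod_ite, Finset.prod_const, Finset.prod_const_one, mul_one,
      Finset.filter_mem_eq_inter, Finset.inter_comm]
  rw [sgn, h1, ← Finset.prod_pow_eq_pow_sum, ← Finset.prod_mul_distrib, Finset.prod_comm]
  refine Finset.prod_congr rfl fun j _ => ?_
  have h2 : ((-1 : ℝ)) ^ (A.filter (fun i => j < i)).card
      = ∏ i ∈ A, (if j < i then (-1 : ℝ) else 1) := by
    rw [Finset.prod_ite, Finset.prod_const, Finset.prod_const_one, mul_one]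
  have h3 : (if j ∈ A then (-1 : ℝ) else 1) = ∏ i ∈ A, (if j = i then (-1 : ℝ) else 1) := by
    rw [Finset.prod_ite_eq]
  rw [h2, h3, ← Finset.prod_mul_distrib]
  refine Finset.prod_congr rfl fun i _ => ?_
  rcases lt_trichotomy j i with h | h | h
  · simp [h, h.ne, h.le]
  · simp [h]
  · simp [h.ne', h.not_gt, h.not_ge]

theorem prod_symmDiff_of_sq {ι : Type*} [DecidableEq ι] (A B : Finset ι) (g : ι → ℝ)
    (hg : ∀ i, g i * g i = 1) :
    ∏ i ∈ symmDiff A B, g i = (∏ i ∈ A, g i) * ∏ i ∈ B, g i := by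
  have hA := Finset.prod_inter_mul_prod_sdiff A B g
  have hB := Finset.prod_inter_mul_prod_sdiff B A g
  have hI : (∏ i ∈ A ∩ B, g i) * ∏ i ∈ A ∩ B, g i = 1 := by
    rw [← Finset.prod_mul_distrib]
    exact Finset.prod_eq_one fun i _ => hg i
  rw [symmDiff_def, Finset.sup_eq_union, Finset.prod_union disjoint_sdiff_sdiff, ← hA, ← hB,
    Finset.inter_comm B A]
  linear_combination (-(∏ i ∈ A \ B, g i) * ∏ i ∈ B \ A, g i) * hI

theorem sgn_symmDiff_left {m : ℕ} (A B C : Finset (Fin m)) :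
    sgn (symmDiff A B) C = sgn A C * sgn B C := by
  simp only [sgn_eq_prod]
  refine prod_symmDiff_of_sq A B _ fun i => ?_
  rw [← Finset.prod_mul_distrib]
  exact Finset.prod_eq_one fun j _ => by split_ifs <;> norm_num

theorem sgn_symmDiff_right {m : ℕ} (A B C : Finset (Fin m)) :
    sgn A (symmDiff B C) = sgn A B * sgn A C := by
  simp only [sgn_eq_prod]
  rw [← Finset.prod_mul_distrib]
  refine Finset.prod_congr rfl fun i _ => prod_symmDiff_of_sq B C _ fun j => ?_
  split_ifs <;> norm_num

/-- The real Clifford algebra `𝒜_m` with `e_i e_j + e_j e_i = -2 δ_{ij}`.  An element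
`x = ∑_T x_T e_T` is stored as the family of its coordinates `x_T`, `T ⊆ {1, …, m}`, and the norm
is `|x| = (∑_T x_T²)^{1/2}`. -/
def Cl (m : ℕ) : Type := EuclideanSpace ℝ (Finset (Fin m))

namespace Cl

variable {m : ℕ}

instance : NormedAddCommGroup (Cl m) :=
  inferInstanceAs (NormedAddCommGroup (EuclideanSpace ℝ (Finset (Fin m))))

instance : NormedSpace ℝ (Cl m) :=
  inferInstanceAs (NormedSpace ℝ (EuclideanSpace ℝ (Finset (Fin m))))

instance : FiniteDimensional ℝ (Cl m) :=
  inferInstanceAs (FiniteDimensional ℝ (EuclideanSpace ℝ (Finset (Fin m))))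

instance : CompleteSpace (Cl m) :=
  inferInstanceAs (CompleteSpace (EuclideanSpace ℝ (Finset (Fin m))))

/-- The coordinate `x_T`. -/
def coord (x : Cl m) (T : Finset (Fin m)) : ℝ := WithLp.ofLp x T

/-- The Clifford number with prescribed coordinates. -/
def ofCoord (c : Finset (Fin m) → ℝ) : Cl m := WithLp.toLp 2 c

@[simp] theorem coord_ofCoord (c : Finset (Fin m) → ℝ) (T : Finset (Fin m)) :
    (ofCoord c).coord T = c T := rfl

@[ext] theorem ext {x y : Cl m} (h : ∀ T, x.coord T = y.coord T) : x = y :=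
  WithLp.ofLp_injective 2 (funext h)

@[simp] theorem coord_add (x y : Cl m) (T : Finset (Fin m)) :
    (x + y).coord T = x.coord T + y.coord T := rfl

@[simp] theorem coord_zero (T : Finset (Fin m)) : (0 : Cl m).coord T = 0 := rfl

/-- The basic element `e_T`. -/
def e (T : Finset (Fin m)) : Cl m := ofCoord (fun S => if S = T then 1 else 0)

instance : One (Cl m) := ⟨e ∅⟩

/-- `(x y)_C` is the sum of `± x_A y_B` over all `A, B` with `A ∆ B = C`, with the sign of
`e_A e_B = ± e_C`. -/
instance : Mul (Cl m) :=
  ⟨fun x y => ofCoord (fun C => ∑ A, sgn A (symmDiff A C) * (x.coord A * y.coord (symmDiff A C)))⟩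

theorem coord_one (T : Finset (Fin m)) : (1 : Cl m).coord T = if T = ∅ then 1 else 0 := rfl

theorem coord_mul (x y : Cl m) (C : Finset (Fin m)) : (x * y).coord C =
    ∑ A, sgn A (symmDiff A C) * (x.coord A * y.coord (symmDiff A C)) := rfl

private theorem mul_assoc_aux (x y z : Cl m) : x * y * z = x * (y * z) := by
  ext D
  simp only [coord_mul, Finset.mul_sum, Finset.sum_mul]
  rw [Finset.sum_comm]
  refine Finset.sum_congr rfl fun A _ => ?_
  refine Fintype.sum_equiv (Equiv.ofBijective (fun C => symmDiff A C)
    (symmDiff_right_involutive A).bijective) _ _ fun C => ?_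
  have h : symmDiff (symmDiff A C) (symmDiff A D) = symmDiff C D := by
    rw [symmDiff_comm A C, symmDiff_assoc, symmDiff_symmDiff_cancel_left]
  simp only [Equiv.ofBijective_apply, h]
  have h1 : sgn C (symmDiff C D) = sgn A (symmDiff C D) * sgn (symmDiff A C) (symmDiff C D) := by
    rw [← sgn_symmDiff_left, symmDiff_symmDiff_cancel_left]
  have h2 : sgn A (symmDiff A D) = sgn A (symmDiff A C) * sgn A (symmDiff C D) := by
    rw [← sgn_symmDiff_right, symmDiff_assoc, symmDiff_symmDiff_cancel_left]
  rw [h1, h2]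
  ring

instance : Ring (Cl m) :=
  { (inferInstance : AddCommGroup (Cl m)) with
    mul := (· * ·)
    one := 1
    mul_assoc := mul_assoc_aux
    one_mul := fun x => by
      ext C
      rw [coord_mul, Finset.sum_eq_single ∅]
      · rw [← Finset.bot_eq_empty, bot_symmDiff]
        simp [coord_one, sgn]
      · intro A _ hA
        simp [coord_one, hA]
      · simp
    mul_one := fun x => by
      ext C
      rw [coord_mul, Finset.sum_eq_single C]
      · simp [coord_one, sgn]
      · intro A _ hA
        have : symmDiff A C ≠ ∅ := by
          rw [← Finset.bot_eq_empty, Ne, symmDiff_eq_bot]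
          exact hA
        simp [coord_one, this]
      · simp
    left_distrib := fun x y z => by
      ext C
      simp only [coord_mul, coord_add, mul_add, Finset.sum_add_distrib]
    right_distrib := fun x y z => by
      ext C
      simp only [coord_mul, coord_add, add_mul, mul_add, Finset.sum_add_distrib]
    zero_mul := fun x => by
      ext C
      simp [coord_mul]
    mul_zero := fun x => by
      ext C
      simp [coord_mul] }

/-- The conjugation: `conj e_T = (-e_{i_l}) ⋯ (-e_{i_1}) = (-1)^{l(l+1)/2} e_T` for
`e_T = e_{i_1} ⋯ e_{i_l}`. -/
def conj (x : Cl m) : Cl m :=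
  ofCoord (fun T => (-1) ^ (T.card * (T.card + 1) / 2) * x.coord T)

end Cl

/-- The space `ℝ^{m+1}` of the vectors `x = x_0 + x_1 e_1 + ⋯ + x_m e_m`, with its Euclidean
norm. -/
abbrev Para (m : ℕ) : Type := EuclideanSpace ℝ (Fin (m + 1))

variable {m : ℕ}

/-- The embedding `x ↦ x_0 + x_1 e_1 + ⋯ + x_m e_m` of `ℝ^{m+1}` into `𝒜_m`. -/
def toCl (x : Para m) : Cl m := x 0 • (1 : Cl m) + ∑ i : Fin m, x i.succ • Cl.e {i}

/-- `f` is left monogenic in the open set `Ω`: it is of class `C¹` there and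
`∑_{i=0}^m e_i ∂f/∂x_i = 0`, where `e_0 = 1`. -/
def IsLeftMonogenicOn (f : Para m → Cl m) (Ω : Set (Para m)) : Prop :=
  ContDiffOn ℝ 1 f Ω ∧
    ∀ x ∈ Ω, ∑ i : Fin (m + 1),
      toCl (EuclideanSpace.single i (1 : ℝ)) * fderiv ℝ f x (EuclideanSpace.single i 1) = 0

/-- The quadratic mean `((1/ω_m) ∫_{S^m} |f(rη)|² dS(η))^{1/2}`, `ω_m` being the area of `S^m`. -/
def sphereMean (f : Para m → Cl m) (r : ℝ) : ℝ :=
  √(⨍ η : Metric.sphere (0 : Para m) 1, ‖f (r • (η : Para m))‖ ^ 2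
    ∂(volume : Measure (Para m)).toSphere)

/-- Membership in the monogenic Hardy space `ℋ²(B^{m+1})`.  Only the values of `f` in the open
unit ball are relevant. -/
def IsHardy (f : Para m → Cl m) : Prop :=
  IsLeftMonogenicOn f (Metric.ball 0 1) ∧
    BddAbove (Set.range fun r : Set.Ioo (0 : ℝ) 1 => sphereMean f r)

/-- The norm of `ℋ²(B^{m+1})`, `‖f‖ = sup_{0<r<1} ((1/ω_m) ∫_{S^m} |f(rη)|² dS(η))^{1/2}`. -/
def hardyNorm (f : Para m → Cl m) : ℝ := ⨆ r : Set.Ioo (0 : ℝ) 1, sphereMean f r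

/-- The `𝒜_m`-valued inner product of `ℋ²(B^{m+1})`,
`⟨f, g⟩ = lim_{r → 1⁻} (1/ω_m) ∫_{S^m} conj(g(rη)) f(rη) dS(η)`,
which is the integral over `S^m` of the product of the boundary values. -/
def hardyInner (f g : Para m → Cl m) : Cl m :=
  limUnder (𝓝[<] (1 : ℝ)) fun r : ℝ =>
    ⨍ η : Metric.sphere (0 : Para m) 1, Cl.conj (g (r • (η : Para m))) * f (r • (η : Para m))
      ∂(volume : Measure (Para m)).toSphere

/-- The Szegő kernel `S_a(x) = conj(1 - conj(a) x) / |1 - conj(a) x|^{m+1}` of the unit ball. -/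
def szego (a x : Para m) : Cl m :=
  (‖1 - Cl.conj (toCl a) * toCl x‖ ^ (m + 1))⁻¹ • Cl.conj (1 - Cl.conj (toCl a) * toCl x)

/-- The function `G ⟨G, G⟩⁻¹ ⟨f, G⟩`. -/
def projTerm (f G : Para m → Cl m) : Para m → Cl m :=
  fun x => G x * (Ring.inverse (hardyInner G G) * hardyInner f G)

/-- `G / ‖G‖`. -/
def normalized (G : Para m → Cl m) : Para m → Cl m := fun x => (hardyNorm G)⁻¹ • G x

/-- The remainder `f_n = f - ∑_{i=1}^{n-1} B_i ⟨B_i, B_i⟩⁻¹ ⟨f, B_i⟩` (so `f_1 = f`). -/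
def remainder (f : Para m → Cl m) (B : ℕ → Para m → Cl m) (n : ℕ) : Para m → Cl m :=
  fun x => f x - ∑ i ∈ Finset.Ico 1 n, projTerm f (B i) x

/-- `G` is the function `B_{a_1, …, a_{n-1}, b}` of the Takenaka–Malmquist system, where
`B i = B_{a_1, …, a_i}` for `1 ≤ i < n`.  If `b` is different from `a_1, …, a_{n-1}`, it is the
normalized Gram–Schmidt orthogonalization of `S_b` with respect to `B_1, …, B_{n-1}`; otherwise it
is the limit in `ℋ²(B^{m+1})` of the functions `B_{a_1, …, a_{n-1}, b + ρω}` as `ρ → 0⁺`, where `ω`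
is a unit vector. -/
structure IsTMNext (a : ℕ → Para m) (B : ℕ → Para m → Cl m) (n : ℕ) (b ω : Para m)
    (G : Para m → Cl m) : Prop where
  isHardy : IsHardy G
  of_new : (∀ i ∈ Finset.Ico 1 n, a i ≠ b) →
    Set.EqOn G (normalized (remainder (szego b) B n)) (Metric.ball 0 1)
  of_repeated : (∃ i ∈ Finset.Ico 1 n, a i = b) →
    Tendsto (fun ρ : ℝ =>
        hardyNorm (fun x => normalized (remainder (szego (b + ρ • ω)) B n) x - G x))
      (𝓝[>] 0) (𝓝 0)

/-- `B_n = B_{a_1, …, a_n}`, `n ≥ 1`, is a Takenaka–Malmquist system whose parameters `a_n` (and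
directions `ω_n`, which matter only for repeated parameters) are selected for `f` by the maximum
selection principle: at each step, `‖B_n ⟨B_n, B_n⟩⁻¹ ⟨f, B_n⟩‖` is the largest among all
the possible choices of the `n`-th parameter.  The index `0` is not used. -/
structure IsAdaptiveTM (f : Para m → Cl m) (a ω : ℕ → Para m) (B : ℕ → Para m → Cl m) :
    Prop where
  mem_ball : ∀ n, 1 ≤ n → a n ∈ Metric.ball (0 : Para m) 1
  mem_sphere : ∀ n, 1 ≤ n → ω n ∈ Metric.sphere (0 : Para m) 1
  next : ∀ n, 1 ≤ n → IsTMNext a B n (a n) (ω n) (B n)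
  maximal : ∀ n, 1 ≤ n → ∀ b ∈ Metric.ball (0 : Para m) 1, ∀ v ∈ Metric.sphere (0 : Para m) 1,
    ∀ G, IsTMNext a B n b v G → hardyNorm (projTerm f G) ≤ hardyNorm (projTerm f (B n))

/-- The class `ℋ²(B^{m+1}, M)` of all `f ∈ ℋ²(B^{m+1})` with `f = ∑_k B_{b_k} c_k` (convergence in
`ℋ²(B^{m+1})`), where `b_k ∈ B^{m+1}`, `B_b = S_b / ‖S_b‖`, `c_k ∈ 𝒜_m` and `∑_k |c_k| ≤ M`. -/
def IsHardyClass (M : ℝ) (f : Para m → Cl m) : Prop :=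
  IsHardy f ∧ ∃ (b : ℕ → Para m) (c : ℕ → Cl m),
    (∀ k, b k ∈ Metric.ball (0 : Para m) 1) ∧
    (Summable fun k => ‖c k‖) ∧ (∑' k, ‖c k‖) ≤ M ∧
    Tendsto (fun K : ℕ =>
        hardyNorm (fun x => f x - ∑ k ∈ Finset.range K, normalized (szego (b k)) x * c k))
      atTop (𝓝 0)

end CliffordTM

end

open CliffordTM

open MeasureTheory Filter Topology

set_option maxSynthPendingDepth 3

noncomputable section

namespace CliffordTM

/-! ### Clifford arithmetic: signs, conjugation, paravectors, the denominator of the Szegő kernel.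
-/

section

variable {m : ℕ}

/-! The scalar part of `⟨f, g⟩` is a real inner product (`reInner`) whose norm is `hardyNorm`, and
the proof is the convergence argument for orthogonal greedy algorithms. Put `A n = ‖f_n‖²` and `d n
= ‖P_{B_n} f‖`. Orthogonality gives `A n = A (n+1) + d n ^ 2` (`hardyNorm_remainder_succ`) and `A n
= Re⟨f_n, f⟩`. Expanding `f = ∑ B_{b_k} c_k` and using the maximum selection principle to bound each
`Re⟨f_n, B_{b_k} c_k⟩` by `d n * |c_k|` gives `A n ≤ M * d n` (`hardyNorm_remainder_sq_le`).
Together, `M² A (n+1) ≤ M² A n - (A n)²`, whence `N * A N ≤ M²` (`nat_mul_le_sq_of_greedy`). The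
bound obtained is `M / √N`; the factor `2^{m/2} ≥ 1` is slack.

Three points need work. The inner product is a limit as `r → 1`, and the norm is a supremum; they
fit together because the spherical means of `|f|²` increase with `r`. This follows from the energy
identity `∫ |∑ e_i ∂_i h|² = ∫ ∑ |∂_i h|²` for compactly supported `h`, applied to radial cutoffs of
`f`.

The norm of `𝒜_m` is not submultiplicative in general; the crude bound for a product costs
`2^{m/2}`. Values of Szegő kernels are multiples of elements `y` with `conj y * y` real, so `|S_b u|
= |S_b| |u|` and nothing is lost (`norm_szego_mul`).

Finally, `⟨G, G⟩` may be a non-invertible Clifford number and `b_k` may repeat an earlier parameter.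
On the ray through `b_k` only finitely many parameters are degenerate (`finite_null_on_ray`), so the
comparison is made at nearby good parameters and passes to the limit (`IsAdaptiveTM.reInner_le`). -/

theorem sgn_mul_self (A B : Finset (Fin m)) : sgn A B * sgn A B = 1 := by
  rw [sgn_eq_prod, ← Finset.prod_mul_distrib]
  refine Finset.prod_eq_one fun i _ => ?_
  rw [← Finset.prod_mul_distrib]
  exact Finset.prod_eq_one fun j _ => by split_ifs <;> norm_num

/-- Adding a new largest element to a set of `l` elements creates `l + 1` factors `-1`, one for each
old element and one for itself. Thus the sign in `conj` is `sgn T T`, and conjugation can be handled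
by the multiplicativity of `sgn`. -/
theorem sgn_self (A : Finset (Fin m)) : sgn A A = (-1) ^ (A.card * (A.card + 1) / 2) := by
  induction A using Finset.induction_on_max with
  | empty => simp [sgn]
  | insert a A ha ih =>
    have hn : a ∉ A := fun h => lt_irrefl _ (ha a h)
    have hc : (A.card + 1) * (A.card + 1 + 1) / 2 = A.card * (A.card + 1) / 2 + (A.card + 1) := by
      have : (A.card + 1) * (A.card + 1 + 1) = A.card * (A.card + 1) + (A.card + 1) * 2 := by ring
      rw [this, Nat.add_mul_div_right _ _ (by norm_num)]
    rw [Finset.card_insert_of_notMem hn, hc, pow_add, ← ih, sgn_eq_prod, sgn_eq_prod,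
      Finset.prod_insert hn, Finset.prod_insert hn]
    have h1 : ∏ j ∈ A, (if j ≤ a then (-1 : ℝ) else 1) = (-1) ^ A.card := by
      rw [← Finset.prod_const]
      exact Finset.prod_congr rfl fun j hj => by simp [(ha j hj).le]
    have h2 : ∏ i ∈ A, ∏ j ∈ insert a A, (if j ≤ i then (-1 : ℝ) else 1)
        = ∏ i ∈ A, ∏ j ∈ A, (if j ≤ i then (-1 : ℝ) else 1) :=
      Finset.prod_congr rfl fun i hi => by
        rw [Finset.prod_insert hn, if_neg (not_le.2 (ha i hi)), one_mul]
    rw [h1, h2, if_pos le_rfl, pow_succ]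
    ring

namespace Cl

instance : InnerProductSpace ℝ (Cl m) :=
  inferInstanceAs (InnerProductSpace ℝ (EuclideanSpace ℝ (Finset (Fin m))))

@[simp] theorem coord_smul (r : ℝ) (x : Cl m) (T : Finset (Fin m)) :
    (r • x).coord T = r * x.coord T := rfl

@[simp] theorem coord_neg (x : Cl m) (T : Finset (Fin m)) : (-x).coord T = -x.coord T := rfl

@[simp] theorem coord_sub (x y : Cl m) (T : Finset (Fin m)) :
    (x - y).coord T = x.coord T - y.coord T := rfl

theorem inner_eq_sum (x y : Cl m) : inner ℝ x y = ∑ T, x.coord T * y.coord T := by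
  have := PiLp.inner_apply (𝕜 := ℝ) (f := fun _ : Finset (Fin m) => ℝ) (WithLp.toLp 2 x.coord)
    (WithLp.toLp 2 y.coord)
  refine Eq.trans this (Finset.sum_congr rfl fun T _ => ?_)
  simp [mul_comm]

instance : Algebra ℝ (Cl m) := Algebra.ofModule
  (fun r x y => by ext C; simp only [coord_mul, coord_smul, Finset.mul_sum]
                   exact Finset.sum_congr rfl fun _ _ => by ring)
  (fun r x y => by ext C; simp only [coord_mul, coord_smul, Finset.mul_sum]
                   exact Finset.sum_congr rfl fun _ _ => by ring)

instance : Nontrivial (Cl m) :=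
  ⟨1, 0, fun h => by simpa [coord_one] using congrArg (fun x : Cl m => x.coord ∅) h⟩

theorem coord_conj (x : Cl m) (T : Finset (Fin m)) : x.conj.coord T = sgn T T * x.coord T := by
  rw [sgn_self]; rfl

theorem conj_add (x y : Cl m) : (x + y).conj = x.conj + y.conj := by
  ext T; simp only [coord_conj, coord_add]; ring

theorem conj_smul (r : ℝ) (x : Cl m) : (r • x).conj = r • x.conj := by
  ext T; simp only [coord_conj, coord_smul]; ring

theorem conj_sub (x y : Cl m) : (x - y).conj = x.conj - y.conj := by
  ext T; simp only [coord_conj, coord_sub]; ring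

theorem conj_zero : (0 : Cl m).conj = 0 := by
  ext T; simp [coord_conj]

theorem conj_one : (1 : Cl m).conj = 1 := by
  ext T; simp only [coord_conj, coord_one]; split_ifs with h
  · simp [h, sgn]
  · simp

theorem conj_conj (x : Cl m) : x.conj.conj = x := by
  ext T; simp only [coord_conj]; rw [← mul_assoc, sgn_mul_self, one_mul]

/-- Multiplicativity in both arguments splits `sgn (A ∆ D) (A ∆ D)` into four signs; the two sides
then differ by the factor `sgn A D * sgn A D = 1`. -/
theorem conj_mul (x y : Cl m) : (x * y).conj = y.conj * x.conj := by
  ext C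
  simp only [coord_conj, coord_mul, Finset.mul_sum]
  refine Fintype.sum_equiv (Equiv.ofBijective (fun A => symmDiff A C)
    (symmDiff_left_involutive C).bijective) _ _ fun A => ?_
  have h : symmDiff (symmDiff A C) C = A := symmDiff_symmDiff_cancel_right C A
  simp only [Equiv.ofBijective_apply, h]
  set D := symmDiff A C
  have hC : C = symmDiff A D := (symmDiff_symmDiff_cancel_left A C).symm
  have h1 : sgn C C = sgn A A * sgn D A * (sgn A D * sgn D D) := by
    have h2 : ∀ A D : Finset (Fin m), sgn (symmDiff A D) (symmDiff A D)
        = sgn A A * sgn D A * (sgn A D * sgn D D) := fun A D => by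
      rw [sgn_symmDiff_right, sgn_symmDiff_left, sgn_symmDiff_left]
    rw [← h2, ← hC]
  rw [h1]
  linear_combination (sgn A A * sgn D A * sgn D D * x.coord A * y.coord D) * sgn_mul_self A D

/-- Only equal indices contribute to the scalar part, and `conj e_A * e_A = 1`. This is the link
between the Clifford-valued and the real inner product. -/
theorem coord_empty_conj_mul (x y : Cl m) : (x.conj * y).coord ∅ = inner ℝ x y := by
  rw [coord_mul, inner_eq_sum]
  refine Finset.sum_congr rfl fun A _ => ?_
  have : symmDiff A ∅ = A := by rw [← Finset.bot_eq_empty, symmDiff_bot]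
  rw [this, coord_conj]
  linear_combination (x.coord A * y.coord A) * sgn_mul_self A A

theorem inner_mul_left (x y z : Cl m) : inner ℝ (x * y) z = inner ℝ y (x.conj * z) := by
  rw [← coord_empty_conj_mul, ← coord_empty_conj_mul, conj_mul, mul_assoc]

theorem inner_conj_conj (x y : Cl m) : inner ℝ x.conj y.conj = inner ℝ x y := by
  simp only [inner_eq_sum, coord_conj]
  refine Finset.sum_congr rfl fun A _ => ?_
  linear_combination (x.coord A * y.coord A) * sgn_mul_self A A

theorem norm_conj (x : Cl m) : ‖x.conj‖ = ‖x‖ := by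
  rw [@norm_eq_sqrt_real_inner (Cl m), @norm_eq_sqrt_real_inner (Cl m), inner_conj_conj]

theorem inner_e (T : Finset (Fin m)) (x : Cl m) : inner ℝ (e T) x = x.coord T := by
  simp [inner_eq_sum, e]

theorem coord_eq_inner (x : Cl m) (T : Finset (Fin m)) :
    x.coord T = ((e T).conj * x).coord ∅ := by
  rw [coord_empty_conj_mul, inner_e]

theorem e_mul_e (A B : Finset (Fin m)) : e A * e B = sgn A B • e (symmDiff A B) := by
  ext C
  rw [coord_mul, Finset.sum_eq_single A]
  · simp only [e, coord_ofCoord, coord_smul, if_true, one_mul]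
    by_cases h : C = symmDiff A B
    · subst h; simp
    · have : symmDiff A C ≠ B := fun h' => h (by rw [← h', symmDiff_symmDiff_cancel_left])
      simp [h, this]
  · intro D _ hD
    simp [e, hD]
  · simp

theorem e_mul_e_add (i j : Fin m) :
    e {i} * e {j} + e {j} * e {i} = (if i = j then (-2 : ℝ) else 0) • (1 : Cl m) := by
  have h1 : (1 : Cl m) = e ∅ := rfl
  have hs : ∀ i j : Fin m, sgn {i} {j} = if j ≤ i then -1 else 1 := fun i j => by
    simp [sgn_eq_prod]
  rw [e_mul_e, e_mul_e, hs, hs, symmDiff_comm ({j} : Finset (Fin m)) {i}, ← add_smul]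
  by_cases h : i = j
  · subst h
    simp only [symmDiff_self, if_true, le_refl, h1, Finset.bot_eq_empty]
    norm_num
  · rcases lt_or_gt_of_ne h with h' | h'
    · simp [h, h'.le, h'.not_ge]
    · simp [h, h'.le, h'.not_ge]

/-- The product as a bounded bilinear map. -/
def mulL : Cl m →L[ℝ] Cl m →L[ℝ] Cl m :=
  LinearMap.toContinuousLinearMap
    ((LinearMap.toContinuousLinearMap : (Cl m →ₗ[ℝ] Cl m) ≃ₗ[ℝ] _).toLinearMap ∘ₗ
      LinearMap.mul ℝ (Cl m))

@[simp] theorem mulL_apply (x y : Cl m) : mulL x y = x * y := rfl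

/-- The conjugation as a bounded linear map. -/
def conjL : Cl m →L[ℝ] Cl m :=
  LinearMap.toContinuousLinearMap
    { toFun := conj, map_add' := conj_add, map_smul' := conj_smul }

@[simp] theorem conjL_apply (x : Cl m) : conjL x = x.conj := rfl

/-- The coordinate `x_T` as a bounded linear functional. -/
def coordL (T : Finset (Fin m)) : Cl m →L[ℝ] ℝ :=
  LinearMap.toContinuousLinearMap
    { toFun := fun x => x.coord T, map_add' := fun _ _ => rfl, map_smul' := fun _ _ => rfl }

@[simp] theorem coordL_apply (T : Finset (Fin m)) (x : Cl m) : coordL T x = x.coord T := rfl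

/-- In finite dimension an injective left multiplication is onto, which gives a right inverse;
injectivity again makes it two-sided. -/
theorem isUnit_of_injective {x : Cl m} (h : ∀ c, x * c = 0 → c = 0) : IsUnit x := by
  have hi : Function.Injective (LinearMap.mulLeft ℝ x) :=
    (injective_iff_map_eq_zero _).2 h
  obtain ⟨y, hy⟩ := (LinearMap.injective_iff_surjective.1 hi) 1
  have hxy : x * y = 1 := hy
  have hyx : y * x = 1 := by
    have : x * (y * x - 1) = 0 := by rw [mul_sub, ← mul_assoc, hxy, one_mul, mul_one, sub_self]
    exact sub_eq_zero.1 (h _ this)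
  exact ⟨⟨x, y, hxy, hyx⟩, rfl⟩

theorem norm_mul_of_conj_mul_self {y : Cl m} {q : ℝ} (hy : y.conj * y = q • 1) (u : Cl m) :
    ‖y * u‖ ^ 2 = q * ‖u‖ ^ 2 := by
  rw [← @real_inner_self_eq_norm_sq (Cl m), ← @real_inner_self_eq_norm_sq (Cl m), inner_mul_left,
    ← mul_assoc, hy, smul_mul_assoc, one_mul, @inner_smul_right]

end Cl

open Cl

theorem toCl_add (x y : Para m) : toCl (x + y) = toCl x + toCl y := by
  simp only [toCl, PiLp.add_apply, add_smul, Finset.sum_add_distrib]; abel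

theorem toCl_smul (r : ℝ) (x : Para m) : toCl (r • x) = r • toCl x := by
  simp only [toCl, PiLp.smul_apply, smul_add, Finset.smul_sum, smul_smul, smul_eq_mul]

/-- The embedding `toCl` as a bounded linear map. -/
def toClL : Para m →L[ℝ] Cl m :=
  LinearMap.toContinuousLinearMap
    { toFun := toCl, map_add' := toCl_add, map_smul' := toCl_smul }

@[simp] theorem toClL_apply (x : Para m) : toClL x = toCl x := rfl

/-- Adding `v * v` to itself with the summation indices exchanged replaces each `e_i e_j` by an
anticommutator. -/
theorem vec_mul_self (x : Fin m → ℝ) :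
    (∑ i, x i • e {i} : Cl m) * ∑ i, x i • e {i} = (-∑ i, x i ^ 2) • 1 := by
  set v : Cl m := ∑ i, x i • e {i}
  have h : v * v = ∑ i, ∑ j, (x i * x j) • (e {i} * e {j} : Cl m) := by
    simp only [v, Finset.sum_mul_sum, smul_mul_smul_comm]
  have h2 : v * v = ∑ i, ∑ j, (x i * x j) • (e {j} * e {i} : Cl m) := by
    rw [h, Finset.sum_comm]
    simp only [mul_comm (x _) (x _)]
  have h3 : v * v + v * v = (2 * -∑ i, x i ^ 2) • 1 := by
    nth_rewrite 1 [h]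
    rw [h2]
    simp only [← Finset.sum_add_distrib, ← smul_add, e_mul_e_add, smul_smul, ← Finset.sum_smul]
    congr 1
    simp only [mul_ite, mul_zero, Finset.sum_ite_eq, Finset.mem_univ, if_true]
    rw [mul_neg, Finset.mul_sum, ← Finset.sum_neg_distrib]
    exact Finset.sum_congr rfl fun i _ => by ring
  have h4 : (2 : ℝ) • (v * v) = (2 : ℝ) • (-∑ i, x i ^ 2) • (1 : Cl m) := by
    rw [two_smul, h3, smul_smul]
  exact smul_right_injective _ (two_ne_zero' ℝ) h4

theorem conj_toCl (x : Para m) :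
    (toCl x).conj = x 0 • 1 - ∑ i : Fin m, x i.succ • (e {i} : Cl m) := by
  have he : ∀ i : Fin m, (e {i} : Cl m).conj = - e {i} := fun i => by
    ext T
    rw [coord_conj, coord_neg]
    simp only [e, coord_ofCoord]
    split_ifs with h
    · subst h; simp [sgn_eq_prod]
    · simp
  have hs : (toCl x).conj = conjL (toCl x) := rfl
  rw [hs, toCl, map_add, map_smul, map_sum]
  simp only [map_smul, conjL_apply, conj_one, he, smul_neg, Finset.sum_neg_distrib]
  abel

theorem norm_sq_para (x : Para m) : ‖x‖ ^ 2 = x 0 ^ 2 + ∑ i : Fin m, x i.succ ^ 2 := by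
  rw [EuclideanSpace.norm_sq_eq, Fin.sum_univ_succ]
  simp

theorem toCl_mul_conj (x : Para m) : toCl x * (toCl x).conj = ‖x‖ ^ 2 • 1 := by
  have := vec_mul_self (fun i : Fin m => x i.succ)
  rw [conj_toCl, norm_sq_para, toCl, add_mul, mul_sub, mul_sub, this]
  simp only [smul_mul_assoc, mul_smul_comm, one_mul, mul_one, add_smul, neg_smul, pow_two, mul_smul]
  abel

theorem conj_mul_toCl (x : Para m) : (toCl x).conj * toCl x = ‖x‖ ^ 2 • 1 := by
  have := vec_mul_self (fun i : Fin m => x i.succ)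
  rw [conj_toCl, norm_sq_para, toCl, sub_mul, mul_add, mul_add, this]
  simp only [smul_mul_assoc, mul_smul_comm, one_mul, mul_one, add_smul, neg_smul, pow_two, mul_smul]
  abel

theorem toCl_mul_conj_add (x y : Para m) :
    toCl x * (toCl y).conj + toCl y * (toCl x).conj = (2 * inner ℝ x y) • 1 := by
  have h := toCl_mul_conj (x + y)
  rw [toCl_add, conj_add, mul_add, add_mul, add_mul, toCl_mul_conj, toCl_mul_conj,
    norm_add_sq_real, add_smul, add_smul] at h
  rw [← sub_eq_zero] at h ⊢
  rw [← h]; abel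

theorem conj_mul_toCl_add (x y : Para m) :
    (toCl x).conj * toCl y + (toCl y).conj * toCl x = (2 * inner ℝ x y) • 1 := by
  have h := conj_mul_toCl (x + y)
  rw [toCl_add, conj_add, mul_add, add_mul, add_mul, conj_mul_toCl, conj_mul_toCl,
    norm_add_sq_real, add_smul, add_smul] at h
  rw [← sub_eq_zero] at h ⊢
  rw [← h]; abel

/-- `|1 - conj(a) x|²` as a real polynomial in `a` and `x`. -/
def szegoQ (a x : Para m) : ℝ := 1 - 2 * inner ℝ a x + ‖a‖ ^ 2 * ‖x‖ ^ 2

theorem szego_denom_conj_mul (a x : Para m) :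
    (1 - (toCl a).conj * toCl x).conj * (1 - (toCl a).conj * toCl x) = szegoQ a x • 1 := by
  have h1 : (toCl x).conj * toCl a * ((toCl a).conj * toCl x) = (‖a‖ ^ 2 * ‖x‖ ^ 2) • 1 := by
    rw [mul_assoc, ← mul_assoc (toCl a), toCl_mul_conj, smul_mul_assoc, one_mul, mul_smul_comm,
      conj_mul_toCl, smul_smul]
  have h2 := conj_mul_toCl_add a x
  rw [conj_sub, conj_one, conj_mul, conj_conj, sub_mul, mul_sub, mul_sub, h1, szegoQ, add_smul,
    sub_smul, ← h2]
  simp only [mul_one, one_mul, one_smul]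
  abel

theorem szego_denom_mul_conj (a x : Para m) :
    (1 - (toCl a).conj * toCl x) * (1 - (toCl a).conj * toCl x).conj = szegoQ a x • 1 := by
  have h1 : (toCl a).conj * toCl x * ((toCl x).conj * toCl a) = (‖a‖ ^ 2 * ‖x‖ ^ 2) • 1 := by
    rw [mul_assoc, ← mul_assoc (toCl x), toCl_mul_conj, smul_mul_assoc, one_mul, mul_smul_comm,
      conj_mul_toCl, smul_smul, mul_comm]
  have h2 := conj_mul_toCl_add a x
  rw [conj_sub, conj_one, conj_mul, conj_conj, sub_mul, mul_sub, mul_sub, h1, szegoQ, add_smul,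
    sub_smul, ← h2]
  simp only [mul_one, one_mul, one_smul]
  abel

theorem norm_szego_denom_sq (a x : Para m) : ‖1 - (toCl a).conj * toCl x‖ ^ 2 = szegoQ a x := by
  have := coord_empty_conj_mul (1 - (toCl a).conj * toCl x) (1 - (toCl a).conj * toCl x)
  rw [real_inner_self_eq_norm_sq, szego_denom_conj_mul] at this
  rw [← this]; simp [coord_one]

/-- The value of the kernel is a real multiple of some `y` with `conj y * y` real, so left
multiplication by it is a similarity. This keeps the constant `2^{m/2}` out of the estimates. -/
theorem norm_szego_mul (a x : Para m) (u : Cl m) : ‖szego a x * u‖ = ‖szego a x‖ * ‖u‖ := by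
  have h : ‖(1 - (toCl a).conj * toCl x).conj * u‖
      = ‖(1 - (toCl a).conj * toCl x).conj‖ * ‖u‖ := by
    have := norm_mul_of_conj_mul_self (y := (1 - (toCl a).conj * toCl x).conj) (q := szegoQ a x)
      (by rw [conj_conj, szego_denom_mul_conj]) u
    rw [← norm_szego_denom_sq, ← mul_pow] at this
    rw [norm_conj]
    exact (sq_eq_sq₀ (norm_nonneg _) (by positivity)).1 this
  rw [szego, smul_mul_assoc, norm_smul, norm_smul, h, mul_assoc]

/-- By Cauchy–Schwarz, `szegoQ a x ≥ (1 - ‖a‖‖x‖)²`. -/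
theorem szegoQ_pos {a x : Para m} (h : ‖a‖ * ‖x‖ < 1) : 0 < szegoQ a x := by
  have h1 := real_inner_le_norm a x
  have h2 : 0 ≤ ‖a‖ * ‖x‖ := by positivity
  rw [szegoQ]
  nlinarith [sq_nonneg (1 - ‖a‖ * ‖x‖), sq_pos_of_pos (sub_pos.2 h)]

end

/-! ### The energy identity for the operator `∑ e_i ∂_i`. -/

section

open scoped Convolution
theorem integral_apply_apply {E T : Type*} [NormedAddCommGroup E] [NormedSpace ℝ E]
    [MeasurableSpace T] {μ : Measure T} {Φ : T → E →L[ℝ] E →L[ℝ] ℝ} (h : Integrable Φ μ) (v w : E) :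
    (∫ t, Φ t ∂μ) v w = ∫ t, Φ t v w ∂μ := by
  rw [ContinuousLinearMap.integral_apply h,
    ContinuousLinearMap.integral_apply (h.apply_continuousLinearMap v)]

/-- The functions are only `C¹`, so integrating by parts twice is not possible. Up to sign, both
sides are mixed second derivatives at `0` of the convolution of `h` with `g(-·)`: one derivative
falls on each factor (`d1`, `d2`), and second derivatives are symmetric. -/
theorem integral_bilin_fderiv_comm {E F : Type*} [NormedAddCommGroup E] [NormedSpace ℝ E]
    [FiniteDimensional ℝ E] [MeasurableSpace E] [BorelSpace E] (μ : Measure E)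
    [μ.IsAddHaarMeasure] [NormedAddCommGroup F] [NormedSpace ℝ F]
    (L : F →L[ℝ] F →L[ℝ] ℝ) {h g : E → F} (hh : ContDiff ℝ 1 h) (hhc : HasCompactSupport h)
    (hg : ContDiff ℝ 1 g) (hgc : HasCompactSupport g) (v w : E) :
    ∫ x, L (fderiv ℝ h x v) (fderiv ℝ g x w) ∂μ = ∫ x, L (fderiv ℝ h x w) (fderiv ℝ g x v) ∂μ := by
  obtain ⟨k, hk⟩ : ∃ k : E → F, k = fun x => g (-x) := ⟨_, rfl⟩
  have hkd : ContDiff ℝ 1 k := hk ▸ hg.comp contDiff_neg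
  have hkc : HasCompactSupport k := hk ▸ hgc.comp_homeomorph (Homeomorph.neg E)
  have hk' : Continuous (fderiv ℝ k) := hkd.continuous_fderiv one_ne_zero
  have hh' : Continuous (fderiv ℝ h) := hh.continuous_fderiv one_ne_zero
  have d1 := fun y =>
    hkc.hasFDerivAt_convolution_right (μ := μ) L hh.continuous.locallyIntegrable hkd y
  have d2 := hhc.hasFDerivAt_convolution_left (μ := μ) (L.precompR E) hh hk'.locallyIntegrable 0
  have key := second_derivative_symmetric d1 d2 v w
  have hint := (hhc.fderiv ℝ).convolutionExists_left (μ := μ) ((L.precompR E).precompL E) hh'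
    hk'.locallyIntegrable 0
  have ev := fun v w => integral_apply_apply hint v w
  have key2 := (ev v w).symm.trans (key.trans (ev w v))
  have hk0 : ∀ t, fderiv ℝ k (0 - t) = - fderiv ℝ g t := fun t => by
    have h1 := (hg.differentiable one_ne_zero (-(0 - t))).hasFDerivAt.comp (0 - t)
      (hasFDerivAt_id (𝕜 := ℝ) (0 - t)).neg
    rw [hk, show (fun x => g (-x)) = g ∘ Neg.neg from rfl, h1.fderiv]; ext v; simp
  simp only [hk0, ContinuousLinearMap.precompL_apply, ContinuousLinearMap.precompR_apply,
    ContinuousLinearMap.compL_apply, ContinuousLinearMap.comp_apply,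
    neg_apply, map_neg, integral_neg] at key2
  exact neg_injective key2

open Cl
variable {m : ℕ}

/-- The `i`-th basic paravector. -/
abbrev ev (i : Fin (m + 1)) : Para m := EuclideanSpace.single i (1 : ℝ)

theorem sum_smul_ev (x : Para m) : ∑ i, x i • (ev i : Para m) = x := by
  ext j; simp [Finset.sum_apply, Pi.single_apply]

/-- Expand the square into terms `(i, j)`. Exchanging the two derivatives in the `(i, j)` term and
adding the `(j, i)` term produces `conj e_i * e_j + conj e_j * e_i = 2 δ_{ij}`, so only the diagonal
survives. -/
theorem integral_norm_dirac_sq {h : Para m → Cl m} (hh : ContDiff ℝ 1 h)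
    (hhc : HasCompactSupport h) :
    ∫ x, ‖∑ i, toCl (ev i) * fderiv ℝ h x (ev i)‖ ^ 2
      = ∫ x, ∑ i : Fin (m + 1), ‖fderiv ℝ h x (ev i)‖ ^ 2 := by
  have hh' : Continuous (fderiv ℝ h) := hh.continuous_fderiv one_ne_zero
  let β : Fin (m + 1) → Fin (m + 1) → (Cl m →L[ℝ] Cl m →L[ℝ] ℝ) := fun i j =>
    (innerSL ℝ).bilinearComp (mulL (toCl (ev i))) (mulL (toCl (ev j)))
  have hβ : ∀ i j x y, β i j x y = inner ℝ (toCl (ev i) * x) (toCl (ev j) * y) :=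
    fun i j x y => rfl
  have hint : ∀ (L : Cl m →L[ℝ] Cl m →L[ℝ] ℝ) (v w : Para m),
      Integrable (fun x => L (fderiv ℝ h x v) (fderiv ℝ h x w)) := fun L v w => by
    refine Continuous.integrable_of_hasCompactSupport (by fun_prop) ?_
    refine (hhc.fderiv ℝ).mono fun t ht => ?_
    contrapose! ht
    simp only [Function.mem_support, not_not] at ht ⊢
    rw [ht]; simp
  have hadd : ∀ i j x y, β i j x y + β j i x y
      = 2 * (if i = j then 1 else 0) * innerSL ℝ x y := fun i j x y => by
    rw [hβ, hβ, inner_mul_left, inner_mul_left, ← inner_add_right, ← mul_assoc, ← mul_assoc,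
      ← add_mul, conj_mul_toCl_add, smul_mul_assoc, one_mul, real_inner_smul_right]
    have : inner ℝ (ev i) (ev j : Para m) = if i = j then (1 : ℝ) else 0 := by
      simp [EuclideanSpace.inner_single_left]
    rw [this]; rfl
  let I : Fin (m + 1) → Fin (m + 1) → ℝ := fun i j =>
    ∫ x, β i j (fderiv ℝ h x (ev i)) (fderiv ℝ h x (ev j))
  have hI : ∀ i j, I i j + I j i
      = 2 * (if i = j then 1 else 0) * ∫ x, innerSL ℝ (fderiv ℝ h x (ev j)) (fderiv ℝ h x (ev i)) := by
    intro i j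
    have : I i j = ∫ x, β i j (fderiv ℝ h x (ev j)) (fderiv ℝ h x (ev i)) :=
      integral_bilin_fderiv_comm volume (β i j) hh hhc hh hhc _ _
    rw [this, ← integral_add (hint _ _ _) (hint _ _ _), ← integral_const_mul]
    exact integral_congr_ae (ae_of_all _ fun x => hadd i j _ _)
  have h1 : ∫ x, ‖∑ i, toCl (ev i) * fderiv ℝ h x (ev i)‖ ^ 2 = ∑ i, ∑ j, I i j := by
    rw [← Finset.sum_congr rfl fun i _ => integral_finsetSum _ fun j _ => hint _ _ _,
      ← integral_finsetSum _ fun i _ => integrable_finsetSum _ fun j _ => hint _ _ _]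
    refine integral_congr_ae (ae_of_all _ fun x => ?_)
    simp only [hβ, ← real_inner_self_eq_norm_sq, sum_inner, inner_sum]
    exact Finset.sum_comm
  have h2 : ∑ i, ∑ j, I i j = ∑ i, ∑ j, I j i := Finset.sum_comm
  have h3 : ∑ i, ∑ j, I i j + ∑ i, ∑ j, I j i
      = 2 * ∑ i, ∫ x, ‖fderiv ℝ h x (ev i)‖ ^ 2 := by
    simp only [← Finset.sum_add_distrib, hI]
    rw [Finset.mul_sum]
    refine Finset.sum_congr rfl fun i _ => ?_
    rw [Finset.sum_eq_single i (fun j _ hj => by simp [hj.symm]) (by simp)]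
    simp
  rw [integral_finsetSum _ fun i _ => by
    exact (hint (innerSL ℝ) (ev i) (ev i)).congr
      (ae_of_all _ fun x => real_inner_self_eq_norm_sq (fderiv ℝ h x (ev i))), h1]
  linarith

/-- With `y = f x`, `D` the derivative of `f` at `x`, `p = Φ(‖x‖²)` and `k = κ(‖x‖²)`, the vectors
in the sums are the partial derivatives of `Φ(‖x‖²) f`. Monogenicity reduces the second sum to `-2k
x y`, whose square cancels the terms in `k²`; what remains is `p² ∑ |D e_i|²`. -/
theorem dirac_pointwise (D : Para m →L[ℝ] Cl m) (y : Cl m) (p k : ℝ) (x : Para m)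
    (h0 : ∑ i, toCl (ev i) * D (ev i) = 0) :
    0 ≤ ∑ i, ‖p • D (ev i) + (-k * (2 * inner ℝ x (ev i))) • y‖ ^ 2
      - ‖∑ i, toCl (ev i) * (p • D (ev i) + (-k * (2 * inner ℝ x (ev i))) • y)‖ ^ 2
      + 4 * (p * k * inner ℝ y (D x)) := by
  have hx : ∀ i, inner ℝ x (ev i) = x i := fun i => by
    simp [EuclideanSpace.inner_single_right]
  have hD : ∑ i, toCl (ev i) * (p • D (ev i) + (-k * (2 * inner ℝ x (ev i))) • y)
      = (-2 * k) • (toCl x * y) := by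
    have hxs : toCl x = ∑ i, x i • toCl (ev i) := by
      conv_lhs => rw [← sum_smul_ev x]
      rw [← toClL_apply, map_sum]; simp [map_smul]
    simp only [hx, mul_add, mul_smul_comm, Finset.sum_add_distrib, ← Finset.smul_sum]
    rw [h0, smul_zero, zero_add, hxs, Finset.sum_mul, Finset.smul_sum]
    refine Finset.sum_congr rfl fun i _ => ?_
    rw [smul_mul_assoc, smul_smul]
    congr 1
    ring
  have hn : ‖toCl x * y‖ ^ 2 = ‖x‖ ^ 2 * ‖y‖ ^ 2 :=
    norm_mul_of_conj_mul_self (conj_mul_toCl x) _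
  have hi : inner ℝ y (D x) = ∑ i, x i * inner ℝ y (D (ev i)) := by
    conv_lhs => rw [← sum_smul_ev x, map_sum, inner_sum]
    simp [map_smul, inner_smul_right]
  have hxx : ‖x‖ ^ 2 = ∑ i, x i ^ 2 := by rw [EuclideanSpace.real_norm_sq_eq]
  have hs : ∀ i, ‖p • D (ev i) + (-k * (2 * inner ℝ x (ev i))) • y‖ ^ 2
      = p ^ 2 * ‖D (ev i)‖ ^ 2 - 4 * (p * k) * (x i * inner ℝ y (D (ev i)))
        + 4 * k ^ 2 * ‖y‖ ^ 2 * x i ^ 2 := by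
    intro i
    rw [norm_add_sq_real, norm_smul, norm_smul, real_inner_smul_left, real_inner_smul_right, hx,
      mul_pow, mul_pow, Real.norm_eq_abs, Real.norm_eq_abs, sq_abs, sq_abs,
      real_inner_comm y]
    ring
  have hsum : ∑ i, ‖p • D (ev i) + (-k * (2 * inner ℝ x (ev i))) • y‖ ^ 2
      = p ^ 2 * ∑ i, ‖D (ev i)‖ ^ 2 - 4 * (p * k) * inner ℝ y (D x)
        + 4 * k ^ 2 * ‖y‖ ^ 2 * ‖x‖ ^ 2 := by
    rw [hi, hxx, Finset.mul_sum, Finset.mul_sum, Finset.mul_sum, ← Finset.sum_sub_distrib,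
      ← Finset.sum_add_distrib]
    exact Finset.sum_congr rfl fun i _ => hs i
  have hsq : ‖(-2 * k) • (toCl x * y)‖ ^ 2 = 4 * k ^ 2 * ‖y‖ ^ 2 * ‖x‖ ^ 2 := by
    rw [norm_smul, mul_pow, hn, Real.norm_eq_abs, sq_abs]
    ring
  rw [hsum, hD, hsq]
  have : 0 ≤ p ^ 2 * ∑ i, ‖D (ev i)‖ ^ 2 :=
    mul_nonneg (sq_nonneg _) (Finset.sum_nonneg fun i _ => sq_nonneg _)
  linarith

/-- Integrate `dirac_pointwise` for `h = Φ(‖x‖²) f`: the first two terms cancel by the energy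
identity. A cutoff in `‖x‖²` is `C¹` at the origin, and its vanishing from `β² < 1` on makes `h`
globally `C¹` whatever `f` is outside the ball. -/
theorem integral_radial_nonneg {f : Para m → Cl m} (hf : IsLeftMonogenicOn f (Metric.ball 0 1))
    {Φ κ : ℝ → ℝ} (hΦ : ∀ s, HasDerivAt Φ (-κ s) s) (hκ : Continuous κ) {β : ℝ} (hβ0 : 0 < β)
    (hβ : β < 1) (hΦ0 : ∀ s, β ^ 2 ≤ s → Φ s = 0) (hκ0 : ∀ s, β ^ 2 ≤ s → κ s = 0) :
    Integrable (fun x => Φ (‖x‖ ^ 2) * κ (‖x‖ ^ 2) * inner ℝ (f x) (fderiv ℝ f x x)) ∧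
    0 ≤ ∫ x, Φ (‖x‖ ^ 2) * κ (‖x‖ ^ 2) * inner ℝ (f x) (fderiv ℝ f x x) := by
  have hΦc : ContDiff ℝ 1 Φ := by
    rw [contDiff_one_iff_deriv]
    refine ⟨fun s => (hΦ s).differentiableAt, ?_⟩
    rw [show deriv Φ = fun s => -κ s from funext fun s => (hΦ s).deriv]
    exact hκ.neg
  have hfd : ∀ x ∈ Metric.ball (0 : Para m) 1, ContDiffAt ℝ 1 f x := fun x hx =>
    (hf.1 x hx).contDiffAt (Metric.isOpen_ball.mem_nhds hx)
  have hlarge : ∀ x : Para m, x ∉ Metric.closedBall (0 : Para m) β → β ^ 2 ≤ ‖x‖ ^ 2 := by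
    intro x hx
    rw [mem_closedBall_zero_iff, not_le] at hx
    gcongr
  set F : Para m → ℝ := fun x => Φ (‖x‖ ^ 2) * κ (‖x‖ ^ 2) * inner ℝ (f x) (fderiv ℝ f x x)
  have hsub : Metric.closedBall (0 : Para m) β ⊆ Metric.ball 0 1 :=
    Metric.closedBall_subset_ball hβ
  have hFi : Integrable F := by
    rw [← integrableOn_iff_integrable_of_support_subset (s := Metric.closedBall (0 : Para m) β)]
    · refine ContinuousOn.integrableOn_compact (isCompact_closedBall _ _) ?_
      have h1 : ContinuousOn f (Metric.closedBall (0 : Para m) β) := hf.1.continuousOn.mono hsub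
      have h2 : ContinuousOn (fderiv ℝ f) (Metric.closedBall (0 : Para m) β) :=
        (hf.1.continuousOn_fderiv_of_isOpen Metric.isOpen_ball le_rfl).mono hsub
      have h3 := hΦc.continuous
      fun_prop
    · intro x hx
      by_contra h
      exact hx (by simp [F, hκ0 _ (hlarge x h)])
  refine ⟨hFi, ?_⟩
  set h : Para m → Cl m := fun x => Φ (‖x‖ ^ 2) • f x
  have hzero : ∀ x : Para m, β < ‖x‖ → h =ᶠ[𝓝 x] fun _ => 0 := by
    intro x hx
    filter_upwards [continuous_norm.continuousAt.eventually (lt_mem_nhds hx)] with y hy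
    have : β ^ 2 ≤ ‖y‖ ^ 2 := by gcongr
    simp [h, hΦ0 _ this]
  have hder : ∀ x ∈ Metric.ball (0 : Para m) 1, ∀ v, fderiv ℝ h x v
      = Φ (‖x‖ ^ 2) • fderiv ℝ f x v + (-κ (‖x‖ ^ 2) * (2 * inner ℝ x v)) • f x := by
    intro x hx v
    have h1 : HasFDerivAt (fun y : Para m => Φ (‖y‖ ^ 2))
        ((-κ (‖x‖ ^ 2)) • (2 • innerSL ℝ x)) x :=
      (hΦ (‖x‖ ^ 2)).comp_hasFDerivAt x (hasStrictFDerivAt_norm_sq x).hasFDerivAt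
    have h2 : HasFDerivAt h _ x :=
      h1.smul ((hfd x hx).differentiableAt one_ne_zero).hasFDerivAt
    rw [h2.fderiv]
    simp
  have hhd : ContDiff ℝ 1 h := by
    rw [contDiff_iff_contDiffAt]
    intro x
    by_cases hx : x ∈ Metric.ball (0 : Para m) 1
    · exact (hΦc.contDiffAt.comp x (contDiff_norm_sq ℝ).contDiffAt).smul (hfd x hx)
    · refine contDiffAt_const.congr_of_eventuallyEq (hzero x ?_)
      rw [mem_ball_zero_iff, not_lt] at hx
      linarith
  have hhc : HasCompactSupport h := by
    refine HasCompactSupport.intro (isCompact_closedBall (0 : Para m) β) fun x hx => ?_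
    simp [h, hΦ0 _ (hlarge x hx)]
  have hh' : Continuous (fderiv ℝ h) := hhd.continuous_fderiv one_ne_zero
  have key := integral_norm_dirac_sq hhd hhc
  have hsupp : ∀ g : (Para m →L[ℝ] Cl m) → ℝ, Continuous g → g 0 = 0 →
      Integrable fun x => g (fderiv ℝ h x) := fun g hg hg0 =>
    (hg.comp hh').integrable_of_hasCompactSupport ((hhc.fderiv ℝ).comp_left hg0)
  have hev : ∀ i : Fin (m + 1), Continuous fun D : Para m →L[ℝ] Cl m => D (ev i) :=
    fun i => continuous_eval_const _
  have i1 : Integrable fun x => ‖∑ i, toCl (ev i) * fderiv ℝ h x (ev i)‖ ^ 2 := by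
    refine hsupp (fun D => ‖∑ i, toCl (ev i) * D (ev i)‖ ^ 2) ?_ (by simp)
    exact (continuous_finsetSum _ fun i _ =>
      (mulL (toCl (ev i))).continuous.comp (hev i)).norm.pow 2
  have i2 : Integrable fun x => ∑ i : Fin (m + 1), ‖fderiv ℝ h x (ev i)‖ ^ 2 :=
    hsupp (fun D => ∑ i : Fin (m + 1), ‖D (ev i)‖ ^ 2)
      (continuous_finsetSum _ fun i _ => (hev i).norm.pow 2) (by simp)
  have hpt : ∀ x, ∑ i : Fin (m + 1), ‖fderiv ℝ h x (ev i)‖ ^ 2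
      - ‖∑ i, toCl (ev i) * fderiv ℝ h x (ev i)‖ ^ 2 + 4 * F x ≥ 0 := by
    intro x
    by_cases hx : x ∈ Metric.ball (0 : Para m) 1
    · simp only [hder x hx]
      exact dirac_pointwise _ _ _ _ x (hf.2 x hx)
    · have h1 : β < ‖x‖ := by
        rw [mem_ball_zero_iff, not_lt] at hx
        linarith
      have h2 : fderiv ℝ h x = 0 := by
        rw [(hzero x h1).fderiv_eq]; simp
      have h3 : F x = 0 := by
        have : β ^ 2 ≤ ‖x‖ ^ 2 := by gcongr
        simp [F, hκ0 _ this]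
      simp [h2, h3]
  have := integral_nonneg (μ := volume) (f := fun x => ∑ i : Fin (m + 1), ‖fderiv ℝ h x (ev i)‖ ^ 2
      - ‖∑ i, toCl (ev i) * fderiv ℝ h x (ev i)‖ ^ 2 + 4 * F x) hpt
  have e := this.trans_eq ((integral_add (i2.sub i1) (hFi.const_mul 4)).trans
    (congrArg₂ (· + ·) (integral_sub i2 i1) (integral_const_mul 4 F)))
  simp only [key, sub_self, zero_add] at e
  linarith

end

/-! ### Polar coordinates and the monotonicity of spherical means. -/

section

open Cl
variable {m : ℕ}

/-- The unit sphere of `ℝ^{m+1}`. -/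
abbrev Sph (m : ℕ) : Type := Metric.sphere (0 : Para m) 1

/-- The surface measure of the unit sphere. -/
abbrev sphMeasure (m : ℕ) : Measure (Sph m) := (volume : Measure (Para m)).toSphere

theorem integral_polar {F : Para m → ℝ} (hF : Integrable F) :
    ∫ x, F x = ∫ r in Set.Ioi (0 : ℝ), r ^ m * ∫ η : Sph m, F (r • (η : Para m)) ∂sphMeasure m := by
  have hdim : Module.finrank ℝ (Para m) - 1 = m := by simp
  have hmp := (volume : Measure (Para m)).measurePreserving_homeomorphUnitSphereProd
  have hme := (homeomorphUnitSphereProd (Para m)).measurableEmbedding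
  let G : Sph m × Set.Ioi (0 : ℝ) → ℝ := fun p => F ((p.2 : ℝ) • (p.1 : Para m))
  have hG : ∀ x : ({0}ᶜ : Set (Para m)), G (homeomorphUnitSphereProd (Para m) x) = F x := by
    intro x
    have h := congrArg Subtype.val ((homeomorphUnitSphereProd (Para m)).symm_apply_apply x)
    rw [homeomorphUnitSphereProd_symm_apply_coe] at h
    simp only [G, h]
  have hi : Integrable G ((sphMeasure m).prod (.volumeIoiPow m)) := by
    rw [hdim] at hmp
    rw [← hmp.integrable_comp_emb hme]
    have : Integrable (fun x : ({0}ᶜ : Set (Para m)) => F x) (volume.comap Subtype.val) := by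
      have := integrableOn_iff_comap_subtypeVal (s := ({0}ᶜ : Set (Para m))) (μ := volume) (f := F)
        (measurableSet_singleton _).compl
      exact this.1 hF.integrableOn
    exact this.congr (ae_of_all _ fun x => (hG x).symm)
  calc ∫ x, F x = ∫ x : ({0}ᶜ : Set (Para m)), F x ∂(volume.comap Subtype.val) := by
        rw [integral_subtype_comap (measurableSet_singleton _).compl F,
          restrict_compl_singleton]
    _ = ∫ p, G p ∂(sphMeasure m).prod (.volumeIoiPow m) := by
        rw [hdim] at hmp
        rw [← hmp.integral_comp hme]
        exact integral_congr_ae (ae_of_all _ fun x => (hG x).symm)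
    _ = ∫ r : Set.Ioi (0 : ℝ), (∫ η : Sph m, F ((r : ℝ) • (η : Para m)) ∂sphMeasure m)
          ∂.volumeIoiPow m := integral_prod_symm _ hi
    _ = _ := by
        simp only [Measure.volumeIoiPow, ENNReal.ofReal]
        rw [integral_withDensity_eq_integral_smul,
          integral_subtype_comap measurableSet_Ioi fun a : ℝ =>
            Real.toNNReal (a ^ m) • ∫ η : Sph m, F (a • (η : Para m)) ∂sphMeasure m,
          setIntegral_congr_fun measurableSet_Ioi fun x hx => ?_]
        · rw [NNReal.smul_def, Real.coe_toNNReal _ (pow_nonneg (le_of_lt hx) _), smul_eq_mul]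
        · exact (measurable_subtype_coe.pow_const _).real_toNNReal

theorem continuousOn_sphere_integral {g : ℝ → Sph m → ℝ} {I : Set ℝ} (hI : IsOpen I)
    (hg : ContinuousOn (Function.uncurry g) (I ×ˢ Set.univ)) :
    ContinuousOn (fun r => ∫ η, g r η ∂sphMeasure m) I := by
  rw [continuousOn_iff_continuous_domRestrict]
  have : LocallyCompactSpace I := hI.locallyCompactSpace
  have h : Continuous (Function.uncurry fun (r : I) (η : Sph m) => g r η) := by
    have h1 : Continuous fun p : I × Sph m => ((p.1 : ℝ), p.2) := by fun_prop
    exact hg.comp_continuous h1 fun p => ⟨p.1.2, trivial⟩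
  have := continuous_parametric_integral_of_continuous (μ := sphMeasure m) h isCompact_univ
  simp only [Measure.restrict_univ] at this
  exact this

theorem hasDerivAt_sphere_integral {g g' : ℝ → Sph m → ℝ} {I : Set ℝ} (hI : IsOpen I)
    (hg : ∀ r ∈ I, Continuous (g r))
    (hg' : ContinuousOn (Function.uncurry g') (I ×ˢ Set.univ))
    (hd : ∀ r ∈ I, ∀ η, HasDerivAt (g · η) (g' r η) r) {r : ℝ} (hr : r ∈ I) :
    HasDerivAt (fun r => ∫ η, g r η ∂sphMeasure m) (∫ η, g' r η ∂sphMeasure m) r := by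
  obtain ⟨δ, hδ, hδI⟩ := Metric.nhds_basis_closedBall.mem_iff.1 (hI.mem_nhds hr)
  have hK : IsCompact (Metric.closedBall r δ ×ˢ (Set.univ : Set (Sph m))) :=
    (isCompact_closedBall _ _).prod isCompact_univ
  obtain ⟨C, hC⟩ := hK.exists_bound_of_continuousOn
    (hg'.mono (Set.prod_mono hδI (Set.Subset.refl _)))
  have hcr : Continuous (g' r) := by
    have h1 : Continuous fun η : Sph m => (r, η) := by fun_prop
    exact hg'.comp_continuous h1 fun p => ⟨hr, trivial⟩
  exact (hasDerivAt_integral_of_dominated_loc_of_deriv_le (bound := fun _ => C)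
    (Metric.closedBall_mem_nhds r hδ)
    (by filter_upwards [hI.mem_nhds hr] with s hs using (hg s hs).aestronglyMeasurable)
    ((hg r hr).integrable_of_hasCompactSupport (.of_compactSpace _)) hcr.aestronglyMeasurable
    (ae_of_all _ fun η s hs => hC (s, η) ⟨hs, trivial⟩) (integrable_const C)
    (ae_of_all _ fun η s hs => hd s (hδI hs) η)).2

theorem smul_mem_ball {r : ℝ} (hr : r ∈ Set.Ioo (0 : ℝ) 1) (η : Sph m) :
    r • (η : Para m) ∈ Metric.ball (0 : Para m) 1 := by
  have : ‖(η : Para m)‖ = 1 := by simp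
  rw [mem_ball_zero_iff, norm_smul, this, mul_one, Real.norm_eq_abs, abs_of_pos hr.1]
  exact hr.2

/-- A nonnegative continuous function supported in `[a, b]` and positive inside. -/
def bumpFun (a b s : ℝ) : ℝ := max 0 ((s - a) * (b - s))

theorem continuous_bumpFun (a b : ℝ) : Continuous (bumpFun a b) := by
  unfold bumpFun; fun_prop

theorem bumpFun_pos {a b s : ℝ} (h1 : a < s) (h2 : s < b) : 0 < bumpFun a b s :=
  lt_max_of_lt_right (mul_pos (sub_pos.2 h1) (sub_pos.2 h2))

theorem bumpFun_of_le {a b s : ℝ} (hab : a ≤ b) (h : s ≤ a) : bumpFun a b s = 0 :=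
  max_eq_left (mul_nonpos_of_nonpos_of_nonneg (by linarith) (by linarith))

theorem bumpFun_of_ge {a b s : ℝ} (hab : a ≤ b) (h : b ≤ s) : bumpFun a b s = 0 :=
  max_eq_left (mul_nonpos_of_nonneg_of_nonpos (by linarith) (by linarith))

/-- The primitive of `-bumpFun a b` that vanishes for `s ≥ b`. -/
def bumpInt (a b s : ℝ) : ℝ := ∫ t in s..b, bumpFun a b t

theorem hasDerivAt_bumpInt (a b s : ℝ) : HasDerivAt (bumpInt a b) (-bumpFun a b s) s :=
  intervalIntegral.integral_hasDerivAt_left ((continuous_bumpFun a b).intervalIntegrable _ _)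
    (continuous_bumpFun a b).stronglyMeasurable.stronglyMeasurableAtFilter
    (continuous_bumpFun a b).continuousAt

theorem bumpInt_of_ge {a b s : ℝ} (hab : a ≤ b) (h : b ≤ s) : bumpInt a b s = 0 := by
  rw [bumpInt, intervalIntegral.integral_congr (g := fun _ => 0)]
  · simp
  · intro t ht
    rw [Set.uIcc_of_ge h] at ht
    exact bumpFun_of_ge hab ht.1

theorem bumpInt_pos {a b s : ℝ} (h1 : a < s) (h2 : s < b) : 0 < bumpInt a b s :=
  intervalIntegral.intervalIntegral_pos_of_pos_on ((continuous_bumpFun a b).intervalIntegrable _ _)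
    (fun _ ht => bumpFun_pos (h1.trans ht.1) ht.2) h2

/-- `∫_{S^m} ⟨f(rη), ∂f/∂η (rη)⟩ dS(η)`. -/
def radialPairing (f : Para m → Cl m) (r : ℝ) : ℝ :=
  ∫ η : Sph m, inner ℝ (f (r • (η : Para m))) (fderiv ℝ f (r • (η : Para m)) (η : Para m))
    ∂sphMeasure m

theorem continuousOn_radial_integrand {f : Para m → Cl m}
    (hf : ContDiffOn ℝ 1 f (Metric.ball 0 1)) :
    ContinuousOn (Function.uncurry fun (r : ℝ) (η : Sph m) =>
      (inner ℝ (f (r • (η : Para m))) (fderiv ℝ f (r • (η : Para m)) (η : Para m)) : ℝ))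
      (Set.Ioo 0 1 ×ˢ Set.univ) := by
  have hmap : Set.MapsTo (fun p : ℝ × Sph m => p.1 • (p.2 : Para m)) (Set.Ioo 0 1 ×ˢ Set.univ)
      (Metric.ball 0 1) := fun p hp => smul_mem_ball hp.1 p.2
  have hc : Continuous fun p : ℝ × Sph m => p.1 • (p.2 : Para m) := by fun_prop
  have h1 := hf.continuousOn.comp hc.continuousOn hmap
  have h2 := (hf.continuousOn_fderiv_of_isOpen Metric.isOpen_ball le_rfl).comp
    hc.continuousOn hmap
  have h3 : ContinuousOn (fun p : ℝ × Sph m => (p.2 : Para m)) (Set.Ioo 0 1 ×ˢ Set.univ) := by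
    fun_prop
  exact h1.inner (𝕜 := ℝ) (h2.clm_apply h3)

theorem hasDerivAt_sphere_norm_sq {f : Para m → Cl m}
    (hf : ContDiffOn ℝ 1 f (Metric.ball 0 1)) {r : ℝ} (hr : r ∈ Set.Ioo (0 : ℝ) 1) :
    HasDerivAt (fun r => ∫ η : Sph m, ‖f (r • (η : Para m))‖ ^ 2 ∂sphMeasure m)
      (2 * radialPairing f r) r := by
  rw [radialPairing, ← integral_const_mul]
  refine hasDerivAt_sphere_integral (I := Set.Ioo 0 1)
    (g := fun (r : ℝ) (η : Sph m) => ‖f (r • (η : Para m))‖ ^ 2)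
    (g' := fun (r : ℝ) (η : Sph m) =>
      2 * inner ℝ (f (r • (η : Para m))) (fderiv ℝ f (r • (η : Para m)) (η : Para m)))
    isOpen_Ioo ?_ ?_ ?_ hr
  · intro s hs
    have : Continuous fun η : Sph m => f (s • (η : Para m)) :=
      hf.continuousOn.comp_continuous (by fun_prop) fun η => smul_mem_ball hs η
    exact this.norm.pow 2
  · exact (continuousOn_radial_integrand hf).const_mul 2
  · intro s hs η
    have hb := smul_mem_ball hs η
    have h1 : HasFDerivAt f (fderiv ℝ f (s • (η : Para m))) (s • (η : Para m)) :=
      ((hf.differentiableOn one_ne_zero).differentiableAt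
        (Metric.isOpen_ball.mem_nhds hb)).hasFDerivAt
    have h2 : HasDerivAt (fun s : ℝ => s • (η : Para m)) (η : Para m) s := by
      simpa using (hasDerivAt_id s).smul_const (η : Para m)
    have h3 := h1.comp_hasDerivAt s h2
    exact h3.norm_sq

/-- If the pairing were negative at `r`, it would be negative on a thin shell, and a radial weight
living on that shell would contradict `integral_radial_nonneg`. -/
theorem radialPairing_nonneg {f : Para m → Cl m} (hf : IsLeftMonogenicOn f (Metric.ball 0 1))
    {r : ℝ} (hr : r ∈ Set.Ioo (0 : ℝ) 1) : 0 ≤ radialPairing f r := by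
  by_contra! hneg
  have hcont : ContinuousOn (radialPairing f) (Set.Ioo 0 1) :=
    continuousOn_sphere_integral isOpen_Ioo (continuousOn_radial_integrand hf.1)
  have hnhds : {s | radialPairing f s < 0} ∩ Set.Ioo 0 1 ∈ 𝓝 r :=
    inter_mem ((hcont.continuousAt (isOpen_Ioo.mem_nhds hr)).eventually (gt_mem_nhds hneg))
      (isOpen_Ioo.mem_nhds hr)
  obtain ⟨δ, hδ, hδI⟩ := Metric.nhds_basis_closedBall.mem_iff.1 hnhds
  rw [Real.closedBall_eq_Icc] at hδI
  set α := r - δ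
  set β := r + δ
  have hαβ : α < β := by simp only [α, β]; linarith
  have hα : 0 < α := (hδI (Set.left_mem_Icc.2 hαβ.le)).2.1
  have hβ : β < 1 := (hδI (Set.right_mem_Icc.2 hαβ.le)).2.2
  have hab : α ^ 2 ≤ β ^ 2 := by gcongr
  -- The cutoff itself is constant inside the shell; its product with its derivative is positive
  -- exactly for `α < ‖x‖ < β`.
  obtain ⟨hint, hpos⟩ := integral_radial_nonneg hf (hasDerivAt_bumpInt (α ^ 2) (β ^ 2))
    (continuous_bumpFun _ _) (hα.trans hαβ) hβ (fun s hs => bumpInt_of_ge hab hs)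
    (fun s hs => bumpFun_of_ge hab hs)
  rw [integral_polar hint] at hpos
  -- The extra factor `s` arises because the derivative is taken along `x = sη` and not along `η`.
  set W : ℝ → ℝ := fun s => s ^ m * (bumpInt (α ^ 2) (β ^ 2) (s ^ 2) *
    bumpFun (α ^ 2) (β ^ 2) (s ^ 2) * (s * radialPairing f s))
  have hW : ∀ s ∈ Set.Ioi (0 : ℝ), s ^ m * ∫ η : Sph m,
      bumpInt (α ^ 2) (β ^ 2) (‖s • (η : Para m)‖ ^ 2) *
      bumpFun (α ^ 2) (β ^ 2) (‖s • (η : Para m)‖ ^ 2) *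
      inner ℝ (f (s • (η : Para m))) (fderiv ℝ f (s • (η : Para m)) (s • (η : Para m)))
        ∂sphMeasure m = W s := by
    intro s hs
    have hn : ∀ η : Sph m, ‖s • (η : Para m)‖ = s := fun η => by
      have : ‖(η : Para m)‖ = 1 := by simp
      rw [norm_smul, this, mul_one, Real.norm_eq_abs, abs_of_pos hs]
    simp only [hn, map_smul, real_inner_smul_right, integral_const_mul, W, radialPairing]
  rw [setIntegral_congr_fun measurableSet_Ioi hW] at hpos
  have hsub : Set.Ioo α β ⊆ Set.Ioi 0 := fun s hs => hα.trans hs.1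
  have hW0 : ∀ s ∈ Set.Ioi (0 : ℝ) \ Set.Ioo α β, W s = 0 := by
    rintro s ⟨hs0, hs⟩
    have : bumpFun (α ^ 2) (β ^ 2) (s ^ 2) = 0 := by
      rcases le_or_gt s α with h | h
      · exact bumpFun_of_le hab (by have : 0 < s := hs0; gcongr)
      · have : β ≤ s := not_lt.1 fun h' => hs ⟨h, h'⟩
        exact bumpFun_of_ge hab (by have : 0 < β := hα.trans hαβ; gcongr)
    simp [W, this]
  rw [setIntegral_eq_of_subset_of_forall_sdiff_eq_zero measurableSet_Ioi hsub hW0,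
    ← integral_Ioc_eq_integral_Ioo, ← intervalIntegral.integral_of_le hαβ.le] at hpos
  have hΦc : Continuous (bumpInt (α ^ 2) (β ^ 2)) :=
    continuous_iff_continuousAt.2 fun s => (hasDerivAt_bumpInt _ _ s).continuousAt
  have hWc : ContinuousOn W (Set.uIcc α β) := by
    rw [Set.uIcc_of_le hαβ.le]
    have h1 := hcont.mono fun s hs => (hδI hs).2
    have h2 := continuous_bumpFun (α ^ 2) (β ^ 2)
    fun_prop
  have hlt : 0 < ∫ s in α..β, -W s := by
    refine intervalIntegral.intervalIntegral_pos_of_pos_on hWc.neg.intervalIntegrable ?_ hαβ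
    intro s hs
    have hs0 : 0 < s := hα.trans hs.1
    have h1 : α ^ 2 < s ^ 2 := by gcongr; exact hs.1
    have h2 : s ^ 2 < β ^ 2 := by gcongr; exact hs.2
    have h3 := bumpInt_pos h1 h2
    have h4 := bumpFun_pos h1 h2
    have h5 : 0 < -radialPairing f s := neg_pos.2 (hδI (Set.Ioo_subset_Icc_self hs)).1
    have : -W s = s ^ m * (bumpInt (α ^ 2) (β ^ 2) (s ^ 2) *
      bumpFun (α ^ 2) (β ^ 2) (s ^ 2) * (s * -radialPairing f s)) := by simp only [W]; ring
    rw [this]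
    positivity
  rw [intervalIntegral.integral_neg] at hlt
  linarith

/-- The spherical means of `|f|²` of a left monogenic function increase with the radius. -/
theorem monotoneOn_sphere_norm_sq {f : Para m → Cl m}
    (hf : IsLeftMonogenicOn f (Metric.ball 0 1)) :
    MonotoneOn (fun r : ℝ => ∫ η : Sph m, ‖f (r • (η : Para m))‖ ^ 2 ∂sphMeasure m)
      (Set.Ioo 0 1) := by
  refine monotoneOn_of_deriv_nonneg (convex_Ioo 0 1) ?_ ?_ ?_
  · exact fun r hr => (hasDerivAt_sphere_norm_sq hf.1 hr).continuousAt.continuousWithinAt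
  · rw [interior_Ioo]
    exact fun r hr => (hasDerivAt_sphere_norm_sq hf.1 hr).differentiableAt.differentiableWithinAt
  · rw [interior_Ioo]
    intro r hr
    rw [(hasDerivAt_sphere_norm_sq hf.1 hr).deriv]
    have := radialPairing_nonneg hf hr
    positivity

end

/-! ### The Hardy space as a right module, and the existence of the limits at the boundary. -/

section

open Cl
variable {m : ℕ}

theorem sphMeasure_real_pos : 0 < (sphMeasure m).real Set.univ := by
  rw [Measure.real, ENNReal.toReal_pos_iff]
  exact ⟨Measure.measure_univ_pos.2 (Measure.toSphere_ne_zero _), measure_lt_top _ _⟩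

theorem continuous_dilate {F : Type*} [TopologicalSpace F] {f : Para m → F}
    (hf : ContinuousOn f (Metric.ball 0 1)) {r : ℝ} (hr : r ∈ Set.Ioo (0 : ℝ) 1) :
    Continuous fun η : Sph m => f (r • (η : Para m)) :=
  hf.comp_continuous (by fun_prop) fun η => smul_mem_ball hr η

theorem integrable_of_continuous_sphere {F : Type*} [NormedAddCommGroup F] {g : Sph m → F}
    (hg : Continuous g) : Integrable g (sphMeasure m) :=
  hg.integrable_of_hasCompactSupport (.of_compactSpace _)

theorem average_add_sphere {F : Type*} [NormedAddCommGroup F] [NormedSpace ℝ F]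
    {g h : Sph m → F} (hg : Continuous g) (hh : Continuous h) :
    ⨍ η, (g η + h η) ∂sphMeasure m = ⨍ η, g η ∂sphMeasure m + ⨍ η, h η ∂sphMeasure m := by
  simp only [average_eq]
  rw [integral_add (integrable_of_continuous_sphere hg) (integrable_of_continuous_sphere hh),
    smul_add]

theorem average_clm_sphere {F G : Type*} [NormedAddCommGroup F] [NormedSpace ℝ F] [CompleteSpace F]
    [NormedAddCommGroup G] [NormedSpace ℝ G] [CompleteSpace G] (L : F →L[ℝ] G)
    {g : Sph m → F} (hg : Continuous g) :
    ⨍ η, L (g η) ∂sphMeasure m = L (⨍ η, g η ∂sphMeasure m) := by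
  simp only [average_eq]
  rw [L.integral_comp_comm (integrable_of_continuous_sphere hg), map_smul]

theorem average_const_mul_sphere (c : ℝ) (g : Sph m → ℝ) :
    ⨍ η, c * g η ∂sphMeasure m = c * ⨍ η, g η ∂sphMeasure m := by
  simp only [average_eq, smul_eq_mul]
  rw [integral_const_mul]
  ring

theorem average_mono_sphere {g h : Sph m → ℝ} (hg : Continuous g) (hh : Continuous h)
    (hgh : ∀ η, g η ≤ h η) : ⨍ η, g η ∂sphMeasure m ≤ ⨍ η, h η ∂sphMeasure m := by
  simp only [average_eq, smul_eq_mul]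
  exact mul_le_mul_of_nonneg_left (integral_mono (integrable_of_continuous_sphere hg)
    (integrable_of_continuous_sphere hh) hgh) (inv_nonneg.2 sphMeasure_real_pos.le)

theorem average_const_sphere (c : ℝ) : ⨍ _η : Sph m, c ∂sphMeasure m = c := by
  have : NeZero (sphMeasure m) := ⟨Measure.toSphere_ne_zero _⟩
  exact average_const _ _

/-- The average of `|f|²` over the sphere of radius `r`. -/
def meanSq (f : Para m → Cl m) (r : ℝ) : ℝ :=
  ⨍ η : Sph m, ‖f (r • (η : Para m))‖ ^ 2 ∂sphMeasure m

theorem meanSq_nonneg (f : Para m → Cl m) (r : ℝ) : 0 ≤ meanSq f r := by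
  rw [meanSq, average_eq]
  exact smul_nonneg (inv_nonneg.2 sphMeasure_real_pos.le) (integral_nonneg fun _ => sq_nonneg _)

theorem sphereMean_eq_sqrt (f : Para m → Cl m) (r : ℝ) : sphereMean f r = √(meanSq f r) := rfl

theorem sphereMean_sq (f : Para m → Cl m) (r : ℝ) : sphereMean f r ^ 2 = meanSq f r :=
  Real.sq_sqrt (meanSq_nonneg f r)

theorem hardyNorm_nonneg (f : Para m → Cl m) : 0 ≤ hardyNorm f :=
  Real.iSup_nonneg fun _ => Real.sqrt_nonneg _

theorem isHardy_iff {f : Para m → Cl m} : IsHardy f ↔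
    IsLeftMonogenicOn f (Metric.ball 0 1) ∧ ∃ C, ∀ r ∈ Set.Ioo (0 : ℝ) 1, meanSq f r ≤ C := by
  refine and_congr_right fun _ => ⟨?_, ?_⟩
  · rintro ⟨C, hC⟩
    refine ⟨C ^ 2, fun r hr => ?_⟩
    rw [← sphereMean_sq]
    exact pow_le_pow_left₀ (Real.sqrt_nonneg _) (hC ⟨⟨r, hr⟩, rfl⟩) 2
  · rintro ⟨C, hC⟩
    refine ⟨√C, ?_⟩
    rintro _ ⟨r, rfl⟩
    exact Real.sqrt_le_sqrt (hC r r.2)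

theorem hardyNorm_le_of_meanSq_le {f : Para m → Cl m} {C : ℝ} (hC : 0 ≤ C)
    (h : ∀ r ∈ Set.Ioo (0 : ℝ) 1, meanSq f r ≤ C ^ 2) : hardyNorm f ≤ C := by
  have : Nonempty (Set.Ioo (0 : ℝ) 1) := ⟨⟨1 / 2, by norm_num, by norm_num⟩⟩
  refine ciSup_le fun r => ?_
  rw [sphereMean_eq_sqrt]
  exact Real.sqrt_le_iff.2 ⟨hC, h r r.2⟩

theorem IsLeftMonogenicOn.differentiableAt {f : Para m → Cl m}
    (hf : IsLeftMonogenicOn f (Metric.ball 0 1)) {x : Para m} (hx : x ∈ Metric.ball (0 : Para m) 1) :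
    DifferentiableAt ℝ f x :=
  (hf.1.differentiableOn one_ne_zero).differentiableAt (Metric.isOpen_ball.mem_nhds hx)

theorem isLeftMonogenicOn_add {f g : Para m → Cl m} (hf : IsLeftMonogenicOn f (Metric.ball 0 1))
    (hg : IsLeftMonogenicOn g (Metric.ball 0 1)) :
    IsLeftMonogenicOn (fun x => f x + g x) (Metric.ball 0 1) := by
  refine ⟨hf.1.add hg.1, fun x hx => ?_⟩
  rw [fderiv_fun_add (hf.differentiableAt hx) (hg.differentiableAt hx)]
  simp only [add_apply, mul_add, Finset.sum_add_distrib]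
  rw [hf.2 x hx, hg.2 x hx, add_zero]

theorem isLeftMonogenicOn_mul_const {f : Para m → Cl m}
    (hf : IsLeftMonogenicOn f (Metric.ball 0 1)) (c : Cl m) :
    IsLeftMonogenicOn (fun x => f x * c) (Metric.ball 0 1) := by
  let R : Cl m →L[ℝ] Cl m := mulL.flip c
  refine ⟨R.contDiff.comp_contDiffOn hf.1, fun x hx => ?_⟩
  have h : HasFDerivAt (fun x => f x * c) (R ∘L fderiv ℝ f x) x :=
    R.hasFDerivAt.comp x (hf.differentiableAt hx).hasFDerivAt
  have hR : ∀ y, R y = y * c := fun y => rfl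
  rw [h.fderiv]
  simp only [ContinuousLinearMap.comp_apply, hR, ← mul_assoc, ← Finset.sum_mul]
  rw [hf.2 x hx, zero_mul]

theorem norm_mul_const_le (c : Cl m) : ∃ K : ℝ, 0 ≤ K ∧ ∀ x : Cl m, ‖x * c‖ ≤ K * ‖x‖ :=
  ⟨‖mulL.flip c‖, norm_nonneg _, fun x => (mulL.flip c).le_opNorm x⟩

namespace IsHardy

variable {f g : Para m → Cl m}

theorem continuousOn (hf : IsHardy f) : ContinuousOn f (Metric.ball 0 1) := hf.1.1.continuousOn

theorem dilate (hf : IsHardy f) {r : ℝ} (hr : r ∈ Set.Ioo (0 : ℝ) 1) :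
    Continuous fun η : Sph m => f (r • (η : Para m)) := continuous_dilate hf.continuousOn hr

theorem dilate_sq (hf : IsHardy f) {r : ℝ} (hr : r ∈ Set.Ioo (0 : ℝ) 1) :
    Continuous fun η : Sph m => ‖f (r • (η : Para m))‖ ^ 2 := (hf.dilate hr).norm.pow 2

theorem add (hf : IsHardy f) (hg : IsHardy g) : IsHardy fun x => f x + g x := by
  obtain ⟨_, C, hC⟩ := isHardy_iff.1 hf
  obtain ⟨_, D, hD⟩ := isHardy_iff.1 hg
  refine isHardy_iff.2 ⟨isLeftMonogenicOn_add hf.1 hg.1, 2 * C + 2 * D, fun r hr => ?_⟩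
  have h1 := hf.dilate_sq hr
  have h2 := hg.dilate_sq hr
  have h3 : Continuous fun η : Sph m => ‖f (r • (η : Para m)) + g (r • (η : Para m))‖ ^ 2 :=
    ((hf.dilate hr).add (hg.dilate hr)).norm.pow 2
  calc meanSq (fun x => f x + g x) r
      ≤ ⨍ η : Sph m, (2 * (‖f (r • (η : Para m))‖ ^ 2)
        + 2 * (‖g (r • (η : Para m))‖ ^ 2)) ∂sphMeasure m := by
        refine average_mono_sphere h3 (by fun_prop) fun η => ?_
        have := norm_add_le (f (r • (η : Para m))) (g (r • (η : Para m)))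
        nlinarith [norm_nonneg (f (r • (η : Para m)) + g (r • (η : Para m))),
          sq_nonneg (‖f (r • (η : Para m))‖ - ‖g (r • (η : Para m))‖)]
    _ = 2 * meanSq f r + 2 * meanSq g r := by
        rw [average_add_sphere (by fun_prop) (by fun_prop), average_const_mul_sphere,
          average_const_mul_sphere]
        rfl
    _ ≤ _ := by linarith [hC r hr, hD r hr]

theorem mul_const (hf : IsHardy f) (c : Cl m) : IsHardy fun x => f x * c := by
  obtain ⟨_, C, hC⟩ := isHardy_iff.1 hf
  obtain ⟨K, hK, hKc⟩ := norm_mul_const_le c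
  refine isHardy_iff.2 ⟨isLeftMonogenicOn_mul_const hf.1 c, K ^ 2 * C, fun r hr => ?_⟩
  have h1 := hf.dilate_sq hr
  have h2 : Continuous fun η : Sph m => f (r • (η : Para m)) * c :=
    (mulL.flip c).continuous.comp (hf.dilate hr)
  calc meanSq (fun x => f x * c) r
      ≤ ⨍ η : Sph m, (K ^ 2 * (‖f (r • (η : Para m))‖ ^ 2))
        ∂sphMeasure m := by
        refine average_mono_sphere (h2.norm.pow 2) (by fun_prop) fun η => ?_
        rw [← mul_pow]
        exact pow_le_pow_left₀ (norm_nonneg _) (hKc _) 2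
    _ = K ^ 2 * meanSq f r := by rw [average_const_mul_sphere]; rfl
    _ ≤ _ := mul_le_mul_of_nonneg_left (hC r hr) (sq_nonneg _)

theorem smul (hf : IsHardy f) (c : ℝ) : IsHardy fun x => c • f x := by
  have := hf.mul_const (c • 1)
  simpa only [mul_smul_comm, mul_one] using this

theorem zero : IsHardy fun _ : Para m => (0 : Cl m) := by
  refine isHardy_iff.2 ⟨⟨contDiffOn_const, fun x _ => by simp⟩, 0, fun r _ => ?_⟩
  simp [meanSq, average_eq]

theorem sub (hf : IsHardy f) (hg : IsHardy g) : IsHardy fun x => f x - g x := by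
  have := hf.add (hg.smul (-1))
  simpa only [neg_smul, one_smul, ← sub_eq_add_neg] using this

theorem sum {ι : Type*} (s : Finset ι) {F : ι → Para m → Cl m} (h : ∀ i ∈ s, IsHardy (F i)) :
    IsHardy fun x => ∑ i ∈ s, F i x := by
  classical
  induction s using Finset.induction_on with
  | empty => simpa using zero
  | insert a s ha ih =>
    simp only [Finset.sum_insert ha]
    exact (h a (Finset.mem_insert_self _ _)).add
      (ih fun i hi => h i (Finset.mem_insert_of_mem hi))

/-- Monotonicity turns the supremum in the norm into a limit, so that identities between quadratic
means pass to the norm. -/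
theorem tendsto_meanSq (hf : IsHardy f) :
    Tendsto (meanSq f) (𝓝[<] 1) (𝓝 (hardyNorm f ^ 2)) := by
  have hmono : MonotoneOn (sphereMean f) (Set.Ioo 0 1) := by
    intro r hr s hs hrs
    rw [sphereMean_eq_sqrt, sphereMean_eq_sqrt]
    refine Real.sqrt_le_sqrt ?_
    simp only [meanSq, average_eq, smul_eq_mul]
    exact mul_le_mul_of_nonneg_left (monotoneOn_sphere_norm_sq hf.1 hr hs hrs)
      (inv_nonneg.2 sphMeasure_real_pos.le)
  have hb : BddAbove (sphereMean f '' Set.Ioo 0 1) := by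
    rw [Set.image_eq_range]; exact hf.2
  have h := hmono.tendsto_nhdsWithin_Ioo_left (Set.nonempty_Ioo.2 one_pos) hb
  rw [sSup_image'] at h
  refine (h.pow 2).congr fun r => sphereMean_sq f r

end IsHardy

theorem eventually_mem_Ioo : ∀ᶠ r in 𝓝[<] (1 : ℝ), r ∈ Set.Ioo (0 : ℝ) 1 :=
  Ioo_mem_nhdsLT one_pos

/-- Polarization: the mean of the real product is a quarter of the difference of the means of `|f +
g|²` and `|f - g|²`. -/
theorem exists_tendsto_inner {f g : Para m → Cl m} (hf : IsHardy f) (hg : IsHardy g) :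
    ∃ l, Tendsto (fun r : ℝ => ⨍ η : Sph m,
      inner ℝ (g (r • (η : Para m))) (f (r • (η : Para m))) ∂sphMeasure m) (𝓝[<] 1) (𝓝 l) := by
  have h := ((hf.add hg).tendsto_meanSq.sub (hf.sub hg).tendsto_meanSq).const_mul (1 / 4)
  refine ⟨_, h.congr' ?_⟩
  filter_upwards [eventually_mem_Ioo] with r hr
  have h1 := hf.dilate hr
  have h2 := hg.dilate hr
  have hi : Continuous fun η : Sph m =>
      (inner ℝ (g (r • (η : Para m))) (f (r • (η : Para m))) : ℝ) := h2.inner h1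
  have e : meanSq (fun x => f x + g x) r = ⨍ η : Sph m,
      (‖f (r • (η : Para m)) - g (r • (η : Para m))‖ ^ 2 + 4 * (inner ℝ (g (r • (η : Para m))) (f (r • (η : Para m))))) ∂sphMeasure m := by
    refine congrArg _ (funext fun η => ?_)
    rw [norm_add_sq_real, norm_sub_sq_real,
      real_inner_comm]
    ring
  rw [e, average_add_sphere ((hf.sub hg).dilate_sq hr) (hi.const_mul 4), average_const_mul_sphere]
  simp only [meanSq]
  ring

theorem eq_sum_coord_smul (x : Cl m) : x = ∑ T, x.coord T • e T := by
  ext S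
  rw [← coordL_apply, ← coordL_apply, map_sum]
  simp [e]

/-- The average over the sphere of radius `r` of `conj(g) f`. -/
def meanPair (f g : Para m → Cl m) (r : ℝ) : Cl m :=
  ⨍ η : Sph m, Cl.conj (g (r • (η : Para m))) * f (r • (η : Para m)) ∂sphMeasure m

theorem continuous_pair {f g : Para m → Cl m} (hf : IsHardy f) (hg : IsHardy g) {r : ℝ}
    (hr : r ∈ Set.Ioo (0 : ℝ) 1) :
    Continuous fun η : Sph m => Cl.conj (g (r • (η : Para m))) * f (r • (η : Para m)) := by
  have h1 : Continuous fun η : Sph m => mulL (conjL (g (r • (η : Para m)))) (f (r • (η : Para m))) :=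
    (mulL.continuous.comp (conjL.continuous.comp (hg.dilate hr))).clm_apply (hf.dilate hr)
  exact h1

/-- The `T`-coordinate of `conj(g) f` is the real product of `g e_T` and `f`, so convergence follows
coordinatewise; only then does `limUnder` denote a genuine limit. -/
theorem tendsto_meanPair {f g : Para m → Cl m} (hf : IsHardy f) (hg : IsHardy g) :
    Tendsto (meanPair f g) (𝓝[<] 1) (𝓝 (hardyInner f g)) := by
  refine tendsto_nhds_limUnder ?_
  choose l hl using fun T : Finset (Fin m) => exists_tendsto_inner hf (hg.mul_const (e T))
  refine ⟨∑ T, l T • e T, ?_⟩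
  refine (tendsto_finsetSum _ fun T _ => (hl T).smul_const (e T)).congr' ?_
  filter_upwards [eventually_mem_Ioo] with r hr
  conv_rhs => rw [eq_sum_coord_smul (meanPair f g r)]
  refine Finset.sum_congr rfl fun T _ => ?_
  rw [← coordL_apply, meanPair, ← average_clm_sphere _ (continuous_pair hf hg hr)]
  congr 1
  refine congrArg _ (funext fun η => ?_)
  rw [coordL_apply, coord_eq_inner, ← mul_assoc, ← conj_mul, coord_empty_conj_mul]

end

/-! ### Calculus of the Clifford-valued and real inner products. -/

section

open Cl
variable {m : ℕ} {f f' g h : Para m → Cl m}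

theorem hardyInner_eq_of_eventually {f' g' : Para m → Cl m}
    (h : ∀ r ∈ Set.Ioo (0 : ℝ) 1, meanPair f g r = meanPair f' g' r) :
    hardyInner f g = hardyInner f' g' :=
  congrArg lim (Filter.map_congr (by
    filter_upwards [eventually_mem_Ioo] with r hr using h r hr))

theorem hardyInner_congr_left (hff : Set.EqOn f f' (Metric.ball 0 1)) :
    hardyInner f g = hardyInner f' g :=
  hardyInner_eq_of_eventually fun r hr => by simp only [meanPair, hff (smul_mem_ball hr _)]

theorem hardyInner_zero_left : hardyInner (fun _ => 0) g = 0 := by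
  refine (tendsto_const_nhds (x := (0 : Cl m)).congr fun r => ?_).limUnder_eq
  simp [average_eq]

theorem hardyInner_add_left (hf : IsHardy f) (hf' : IsHardy f') (hg : IsHardy g) :
    hardyInner (fun x => f x + f' x) g = hardyInner f g + hardyInner f' g := by
  refine tendsto_nhds_unique (tendsto_meanPair (hf.add hf') hg)
    (((tendsto_meanPair hf hg).add (tendsto_meanPair hf' hg)).congr' ?_)
  filter_upwards [eventually_mem_Ioo] with r hr
  simp only [meanPair, mul_add]
  exact (average_add_sphere (continuous_pair hf hg hr) (continuous_pair hf' hg hr)).symm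

theorem hardyInner_mul_left (hf : IsHardy f) (hg : IsHardy g) (c : Cl m) :
    hardyInner (fun x => f x * c) g = hardyInner f g * c := by
  refine tendsto_nhds_unique (tendsto_meanPair (hf.mul_const c) hg)
    ((((mulL.flip c).continuous.tendsto _).comp (tendsto_meanPair hf hg)).congr' ?_)
  filter_upwards [eventually_mem_Ioo] with r hr
  refine (average_clm_sphere (mulL.flip c) (continuous_pair hf hg hr)).symm.trans ?_
  simp only [meanPair, ContinuousLinearMap.flip_apply, mulL_apply, mul_assoc]

theorem conj_hardyInner (hf : IsHardy f) (hg : IsHardy g) :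
    (hardyInner f g).conj = hardyInner g f := by
  refine tendsto_nhds_unique
    (((conjL.continuous.tendsto _).comp (tendsto_meanPair hf hg)).congr' ?_)
    (tendsto_meanPair hg hf)
  filter_upwards [eventually_mem_Ioo] with r hr
  refine (average_clm_sphere conjL (continuous_pair hf hg hr)).symm.trans ?_
  simp only [meanPair, conjL_apply, conj_mul, conj_conj]

theorem hardyInner_smul_left (hf : IsHardy f) (hg : IsHardy g) (c : ℝ) :
    hardyInner (fun x => c • f x) g = c • hardyInner f g := by
  have := hardyInner_mul_left hf hg (c • 1)
  simpa only [mul_smul_comm, mul_one] using this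

theorem hardyInner_sub_left (hf : IsHardy f) (hf' : IsHardy f') (hg : IsHardy g) :
    hardyInner (fun x => f x - f' x) g = hardyInner f g - hardyInner f' g := by
  have := hardyInner_add_left hf (hf'.smul (-1)) hg
  rw [hardyInner_smul_left hf' hg] at this
  simpa only [neg_smul, one_smul, ← sub_eq_add_neg] using this

theorem hardyInner_sum_left {ι : Type*} (s : Finset ι) {F : ι → Para m → Cl m}
    (hF : ∀ i ∈ s, IsHardy (F i)) (hg : IsHardy g) :
    hardyInner (fun x => ∑ i ∈ s, F i x) g = ∑ i ∈ s, hardyInner (F i) g := by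
  classical
  induction s using Finset.induction_on with
  | empty => simpa using hardyInner_zero_left
  | insert a s ha ih =>
    have hs : ∀ i ∈ s, IsHardy (F i) := fun i hi => hF i (Finset.mem_insert_of_mem hi)
    simp only [Finset.sum_insert ha]
    rw [hardyInner_add_left (hF a (Finset.mem_insert_self _ _)) (IsHardy.sum s hs) hg, ih hs]

theorem hardyInner_mul_right (hf : IsHardy f) (hg : IsHardy g) (c : Cl m) :
    hardyInner f (fun x => g x * c) = c.conj * hardyInner f g := by
  rw [← conj_hardyInner (hg.mul_const c) hf, hardyInner_mul_left hg hf, conj_mul,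
    conj_hardyInner hg hf]

theorem hardyInner_smul_right (hf : IsHardy f) (hg : IsHardy g) (c : ℝ) :
    hardyInner f (fun x => c • g x) = c • hardyInner f g := by
  rw [← conj_hardyInner (hg.smul c) hf, hardyInner_smul_left hg hf, conj_smul,
    conj_hardyInner hg hf]

theorem hardyInner_sub_right (hf : IsHardy f) (hg : IsHardy g) (hh : IsHardy h) :
    hardyInner f (fun x => g x - h x) = hardyInner f g - hardyInner f h := by
  rw [← conj_hardyInner (hg.sub hh) hf, hardyInner_sub_left hg hh hf, conj_sub,
    conj_hardyInner hg hf, conj_hardyInner hh hf]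

theorem hardyInner_eq_zero_symm (hf : IsHardy f) (hg : IsHardy g) (h : hardyInner f g = 0) :
    hardyInner g f = 0 := by
  rw [← conj_hardyInner hf hg, h, conj_zero]

/-- The real inner product of the Hardy space, the scalar part of `⟨f, g⟩`. -/
def reInner (f g : Para m → Cl m) : ℝ := (hardyInner f g).coord ∅

theorem reInner_self (hf : IsHardy f) : reInner f f = hardyNorm f ^ 2 := by
  refine tendsto_nhds_unique
    ((((coordL ∅).continuous.tendsto _).comp (tendsto_meanPair hf hf)).congr' ?_)
    hf.tendsto_meanSq
  filter_upwards [eventually_mem_Ioo] with r hr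
  refine (average_clm_sphere (coordL ∅) (continuous_pair hf hf hr)).symm.trans ?_
  simp only [meanSq, coordL_apply, coord_empty_conj_mul, real_inner_self_eq_norm_sq]

theorem reInner_comm (hf : IsHardy f) (hg : IsHardy g) : reInner f g = reInner g f := by
  rw [reInner, reInner, ← conj_hardyInner hg hf, coord_conj]
  simp [sgn]

theorem reInner_add_left (hf : IsHardy f) (hf' : IsHardy f') (hg : IsHardy g) :
    reInner (fun x => f x + f' x) g = reInner f g + reInner f' g := by
  rw [reInner, hardyInner_add_left hf hf' hg]; rfl

theorem reInner_sub_left (hf : IsHardy f) (hf' : IsHardy f') (hg : IsHardy g) :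
    reInner (fun x => f x - f' x) g = reInner f g - reInner f' g := by
  rw [reInner, hardyInner_sub_left hf hf' hg]; rfl

theorem reInner_sub_right (hf : IsHardy f) (hg : IsHardy g) (hh : IsHardy h) :
    reInner f (fun x => g x - h x) = reInner f g - reInner f h := by
  rw [reInner, hardyInner_sub_right hf hg hh]; rfl

theorem reInner_smul_left (hf : IsHardy f) (hg : IsHardy g) (c : ℝ) :
    reInner (fun x => c • f x) g = c * reInner f g := by
  rw [reInner, hardyInner_smul_left hf hg]; rfl

/-- Letting `c` vary recovers all of `⟨f, g⟩` from real products, so real Cauchy–Schwarz suffices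
throughout. -/
theorem reInner_mul_right (hf : IsHardy f) (hg : IsHardy g) (c : Cl m) :
    reInner f (fun x => g x * c) = inner ℝ c (hardyInner f g) := by
  rw [reInner, hardyInner_mul_right hf hg, coord_empty_conj_mul]

theorem hardyNorm_add_sq (hf : IsHardy f) (hg : IsHardy g) :
    hardyNorm (fun x => f x + g x) ^ 2
      = hardyNorm f ^ 2 + 2 * reInner f g + hardyNorm g ^ 2 := by
  have hfg := hf.add hg
  rw [← reInner_self hfg, reInner_add_left hf hg hfg, reInner_comm hf hfg, reInner_comm hg hfg,
    reInner_add_left hf hg hf, reInner_add_left hf hg hg, reInner_self hf, reInner_self hg,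
    reInner_comm hg hf]
  ring

theorem hardyNorm_smul (hf : IsHardy f) (c : ℝ) :
    hardyNorm (fun x => c • f x) = |c| * hardyNorm f := by
  have h : hardyNorm (fun x => c • f x) ^ 2 = (|c| * hardyNorm f) ^ 2 := by
    rw [← reInner_self (hf.smul c), reInner_smul_left hf (hf.smul c),
      reInner_comm hf (hf.smul c), reInner_smul_left hf hf, reInner_self hf, mul_pow, sq_abs]
    ring
  exact (sq_eq_sq₀ (hardyNorm_nonneg _) (mul_nonneg (abs_nonneg _) (hardyNorm_nonneg _))).1 h

theorem abs_reInner_le (hf : IsHardy f) (hg : IsHardy g) :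
    |reInner f g| ≤ hardyNorm f * hardyNorm g := by
  have key : ∀ t : ℝ, 0 ≤ hardyNorm g ^ 2 * (t * t) + 2 * reInner f g * t + hardyNorm f ^ 2 := by
    intro t
    have h := hardyNorm_add_sq hf (hg.smul t)
    rw [reInner_comm hf (hg.smul t), reInner_smul_left hg hf, reInner_comm hg hf,
      hardyNorm_smul hg, mul_pow, sq_abs] at h
    nlinarith [sq_nonneg (hardyNorm fun x => f x + t • g x)]
  have hd := discrim_le_zero key
  rw [discrim] at hd
  refine abs_le_of_sq_le_sq ?_ (mul_nonneg (hardyNorm_nonneg _) (hardyNorm_nonneg _))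
  nlinarith

theorem hardyNorm_add_le (hf : IsHardy f) (hg : IsHardy g) :
    hardyNorm (fun x => f x + g x) ≤ hardyNorm f + hardyNorm g := by
  refine le_of_sq_le_sq ?_ (add_nonneg (hardyNorm_nonneg _) (hardyNorm_nonneg _))
  rw [hardyNorm_add_sq hf hg]
  nlinarith [le_abs_self (reInner f g), abs_reInner_le hf hg]

theorem meanSq_le_of_norm_le {C : ℝ} (hf : IsHardy f) (h : ∀ x ∈ Metric.ball 0 1, ‖f x‖ ≤ C)
    {r : ℝ} (hr : r ∈ Set.Ioo (0 : ℝ) 1) : meanSq f r ≤ C ^ 2 := by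
  refine (average_mono_sphere (hf.dilate_sq hr) (continuous_const (y := C ^ 2)) fun η =>
    ?_).trans_eq (average_const_sphere _)
  exact pow_le_pow_left₀ (norm_nonneg _) (h _ (smul_mem_ball hr η)) 2

theorem hardyNorm_le_of_norm_le {C : ℝ} (hC : 0 ≤ C) (hf : IsHardy f)
    (h : ∀ x ∈ Metric.ball 0 1, ‖f x‖ ≤ C) : hardyNorm f ≤ C :=
  hardyNorm_le_of_meanSq_le hC fun _ hr => meanSq_le_of_norm_le hf h hr

/-- A continuous function with vanishing mean square is zero everywhere on the sphere. The pointwise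
form is needed for evaluation along a ray. -/
theorem eq_zero_of_hardyNorm_eq_zero (hf : IsHardy f) (h : hardyNorm f = 0) {r : ℝ}
    (hr : r ∈ Set.Ioo (0 : ℝ) 1) (η : Sph m) : f (r • (η : Para m)) = 0 := by
  have h1 : sphereMean f r ≤ 0 := h ▸ le_ciSup hf.2 (⟨r, hr⟩ : Set.Ioo (0 : ℝ) 1)
  have h2 : meanSq f r = 0 := by
    rw [← sphereMean_sq, le_antisymm h1 (Real.sqrt_nonneg _)]; simp
  rw [meanSq, average_eq, smul_eq_mul, mul_eq_zero] at h2
  have h3 := h2.resolve_left (inv_ne_zero sphMeasure_real_pos.ne')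
  have hc := hf.dilate_sq hr
  rw [integral_eq_zero_iff_of_nonneg (fun η => sq_nonneg _)
    (integrable_of_continuous_sphere hc)] at h3
  have h4 := congrFun ((hc.ae_eq_iff_eq _ continuous_zero).1 h3) η
  simpa using h4

end

/-! ### The Szegő kernel: monogenicity, continuity in the parameter, values on a ray. -/

section

open Cl
variable {m : ℕ}

theorem szego_eq_rpow {a x : Para m} (h : ‖a‖ * ‖x‖ < 1) :
    szego a x = szegoQ a x ^ (-((m : ℝ) + 1) / 2) • (1 - (toCl x).conj * toCl a) := by
  have hq := szegoQ_pos h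
  have h1 : (‖1 - (toCl a).conj * toCl x‖ ^ (m + 1))⁻¹ = szegoQ a x ^ (-((m : ℝ) + 1) / 2) := by
    rw [← norm_szego_denom_sq, ← Real.rpow_natCast _ 2, ← Real.rpow_mul (norm_nonneg _),
      ← Real.rpow_natCast _ (m + 1), ← Real.rpow_neg (norm_nonneg _)]
    congr 1
    push_cast
    ring
  rw [szego, h1, conj_sub, conj_one, conj_mul, conj_conj]

theorem hasFDerivAt_szegoQ (a x : Para m) :
    HasFDerivAt (szegoQ a) (-(2 : ℝ) • innerSL ℝ a + ‖a‖ ^ 2 • ((2 : ℝ) • innerSL ℝ x)) x := by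
  have h1 : HasFDerivAt (fun y : Para m => inner ℝ a y) (innerSL ℝ a) x :=
    (innerSL ℝ a).hasFDerivAt
  have h2 : HasFDerivAt (fun y : Para m => ‖y‖ ^ 2) (2 • innerSL ℝ x) x :=
    (hasStrictFDerivAt_norm_sq x).hasFDerivAt
  have h3 : HasFDerivAt (fun y : Para m => 1 - 2 * inner ℝ a y + ‖a‖ ^ 2 * ‖y‖ ^ 2) _ x :=
    ((h1.const_mul 2).const_sub 1).add (h2.const_mul (‖a‖ ^ 2))
  refine h3.congr_fderiv ?_
  ext v
  simp

theorem contDiff_szegoQ (a : Para m) : ContDiff ℝ 1 (szegoQ a) := by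
  have h1 : ContDiff ℝ 1 (fun y : Para m => (inner ℝ a y : ℝ)) := (innerSL ℝ a).contDiff
  have h2 : ContDiff ℝ 1 (fun y : Para m => ‖y‖ ^ 2) := contDiff_norm_sq ℝ
  exact (contDiff_const.sub (contDiff_const.mul h1)).add (contDiff_const.mul h2)

/-- The map `x ↦ conj(x) a`. -/
def conjMulL (a : Para m) : Para m →L[ℝ] Cl m := (mulL.flip (toCl a)).comp (conjL.comp toClL)

@[simp] theorem conjMulL_apply (a x : Para m) : conjMulL a x = (toCl x).conj * toCl a := rfl

/-- The left factor is half of `∑ e_i ∂_i` applied to `szegoQ a`. The product being a multiple of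
`szegoQ` is what makes the kernel monogenic. -/
theorem szego_numerator_identity (a x : Para m) :
    (‖a‖ ^ 2 • toCl x - toCl a) * (1 - (toCl x).conj * toCl a) = -szegoQ a x • toCl a := by
  have h1 : toCl a * ((toCl x).conj * toCl a)
      = (2 * inner ℝ a x) • toCl a - ‖a‖ ^ 2 • toCl x := by
    have h := toCl_mul_conj_add a x
    rw [← mul_assoc, eq_sub_of_add_eq h, sub_mul, mul_assoc, conj_mul_toCl]
    simp only [smul_mul_assoc, one_mul, mul_smul_comm, mul_one]
  have h2 : toCl x * ((toCl x).conj * toCl a) = ‖x‖ ^ 2 • toCl a := by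
    rw [← mul_assoc, toCl_mul_conj, smul_mul_assoc, one_mul]
  rw [sub_mul, mul_sub, mul_sub, h1, smul_mul_assoc, smul_mul_assoc, h2, szegoQ]
  simp only [mul_one, neg_smul, add_smul, sub_smul, one_smul, mul_smul]
  abel

theorem sum_inner_smul_ev (w : Para m) :
    ∑ i : Fin (m + 1), (inner ℝ w (ev i) : ℝ) • toCl (ev i) = toCl w := by
  conv_rhs => rw [← sum_smul_ev w]
  rw [← toClL_apply, map_sum]
  refine Finset.sum_congr rfl fun i _ => ?_
  rw [map_smul, toClL_apply]
  congr 1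
  simp [EuclideanSpace.inner_single_right]

/-- Differentiate `q^p Y`, `Y = 1 - conj(x) a`. Differentiating `q^p` gives `-2p q^p a`;
differentiating `Y` gives `-(m+1) q^p a`, since `e_i conj(e_i) = 1` for each of the `m + 1` indices.
They cancel for `p = -(m+1)/2`. -/
theorem isLeftMonogenicOn_szego {a : Para m} (ha : a ∈ Metric.ball (0 : Para m) 1) :
    IsLeftMonogenicOn (szego a) (Metric.ball 0 1) := by
  rw [mem_ball_zero_iff] at ha
  have hlt : ∀ x ∈ Metric.ball (0 : Para m) 1, ‖a‖ * ‖x‖ < 1 := fun x hx => by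
    rw [mem_ball_zero_iff] at hx
    nlinarith [norm_nonneg a, norm_nonneg x]
  set p : ℝ := -((m : ℝ) + 1) / 2 with hp
  set Z : Para m → Cl m := fun x => szegoQ a x ^ p • (1 - conjMulL a x) with hZ
  have heq : Set.EqOn (szego a) Z (Metric.ball 0 1) := fun x hx => szego_eq_rpow (hlt x hx)
  refine ⟨ContDiffOn.congr ?_ heq, fun x hx => ?_⟩
  · have hA : ContDiffOn ℝ 1 (fun x => szegoQ a x ^ p) (Metric.ball 0 1) :=
      (contDiff_szegoQ a).contDiffOn.rpow_const_of_ne fun x hx => (szegoQ_pos (hlt x hx)).ne'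
    have hB : ContDiff ℝ 1 fun x => 1 - conjMulL a x := contDiff_const.sub (conjMulL a).contDiff
    exact hA.smul hB.contDiffOn
  · have hq := szegoQ_pos (hlt x hx)
    have h1 := (hasFDerivAt_szegoQ a x).rpow_const (p := p) (Or.inl hq.ne')
    have h2 := (conjMulL a).hasFDerivAt (x := x) |>.const_sub 1
    have h3 : HasFDerivAt Z _ x := h1.smul h2
    rw [(heq.eventuallyEq_of_mem (Metric.isOpen_ball.mem_nhds hx)).fderiv_eq, h3.fderiv]
    set Y : Cl m := 1 - conjMulL a x with hY
    set q := szegoQ a x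
    have hterm : ∀ i : Fin (m + 1), toCl (ev i) * ((q ^ p • (-conjMulL a)
        + ((p * q ^ (p - 1)) • (-(2 : ℝ) • innerSL ℝ a
          + ‖a‖ ^ 2 • ((2 : ℝ) • innerSL ℝ x))).smulRight Y) (ev i))
        = (p * q ^ (p - 1) * 2) • ((inner ℝ (‖a‖ ^ 2 • x - a) (ev i) : ℝ) • toCl (ev i) * Y)
          - q ^ p • toCl a := by
      intro i
      have he : toCl (ev i : Para m) * (toCl (ev i)).conj = 1 := by
        rw [toCl_mul_conj]; simp
      simp only [add_apply, smul_apply, neg_apply, ContinuousLinearMap.smulRight_apply,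
        conjMulL_apply, innerSL_apply_apply, smul_eq_mul, mul_add, mul_smul_comm, mul_neg,
        smul_mul_assoc, smul_smul, inner_sub_left, real_inner_smul_left, smul_neg]
      rw [← mul_assoc (toCl (ev i)), he, one_mul, neg_add_eq_sub]
      exact congrArg (fun s : ℝ => s • (toCl (ev i) * Y) - q ^ p • toCl a) (by ring)
    refine (Finset.sum_congr rfl fun i _ => hterm i).trans ?_
    rw [Finset.sum_sub_distrib, ← Finset.smul_sum, ← Finset.sum_mul, sum_inner_smul_ev,
      show toCl (‖a‖ ^ 2 • x - a) = ‖a‖ ^ 2 • toCl x - toCl a by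
        rw [← toClL_apply, map_sub, map_smul]; rfl,
      hY, conjMulL_apply, szego_numerator_identity, Finset.sum_const, Finset.card_univ,
      Fintype.card_fin, smul_smul, ← Nat.cast_smul_eq_nsmul ℝ, smul_smul, ← sub_smul]
    have hqq : q ^ (p - 1) * q = q ^ p := by
      rw [Real.rpow_sub_one hq.ne']; field_simp
    have : p * q ^ (p - 1) * 2 * -szegoQ a x - ((m + 1 : ℕ) : ℝ) * q ^ p = 0 := by
      have h2p : p * 2 = -((m : ℝ) + 1) := by rw [hp]; ring
      push_cast
      linear_combination (-2 * p) * hqq - q ^ p * h2p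
    rw [this, zero_smul]

theorem continuousOn_szego : ContinuousOn (fun p : Para m × Para m => szego p.1 p.2)
    (Metric.ball 0 1 ×ˢ Metric.closedBall 0 1) := by
  have h1 : Continuous fun p : Para m × Para m => 1 - (toCl p.1).conj * toCl p.2 := by
    have : Continuous fun p : Para m × Para m => mulL (conjL (toClL p.1)) (toClL p.2) := by fun_prop
    exact continuous_const.sub this
  have h2 : Continuous fun p : Para m × Para m => (1 - (toCl p.1).conj * toCl p.2).conj :=
    conjL.continuous.comp h1
  refine ContinuousOn.smul (ContinuousOn.inv₀ (h1.norm.pow _).continuousOn ?_) h2.continuousOn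
  rintro ⟨a, x⟩ ⟨ha, hx⟩
  rw [mem_ball_zero_iff] at ha
  rw [mem_closedBall_zero_iff] at hx
  have hlt : ‖a‖ * ‖x‖ < 1 := by nlinarith [norm_nonneg a, norm_nonneg x]
  have hq := szegoQ_pos hlt
  rw [← norm_szego_denom_sq] at hq
  have : ‖1 - (toCl a).conj * toCl x‖ ≠ 0 := fun h => by simp [h] at hq
  exact pow_ne_zero _ this

theorem isHardy_szego {a : Para m} (ha : a ∈ Metric.ball (0 : Para m) 1) : IsHardy (szego a) := by
  have hm := isLeftMonogenicOn_szego ha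
  have hpair : ContinuousOn (fun x : Para m => (a, x)) (Metric.closedBall 0 1) :=
    (Continuous.prodMk_right a).continuousOn
  have hc : ContinuousOn (szego a) (Metric.closedBall 0 1) := by
    have := continuousOn_szego.comp hpair fun x hx => ⟨ha, hx⟩
    exact this
  obtain ⟨C, hC⟩ := (isCompact_closedBall (0 : Para m) 1).exists_bound_of_continuousOn hc
  refine isHardy_iff.2 ⟨hm, C ^ 2, fun r hr => ?_⟩
  refine (average_mono_sphere ((continuous_dilate hm.1.continuousOn hr).norm.pow 2)
    (continuous_const (y := C ^ 2)) fun η => ?_).trans_eq (average_const_sphere _)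
  exact pow_le_pow_left₀ (norm_nonneg _)
    (hC _ (Metric.ball_subset_closedBall (smul_mem_ball hr η))) 2

theorem hardyNorm_szego_mul_le {a : Para m} (ha : a ∈ Metric.ball (0 : Para m) 1) (u : Cl m) :
    hardyNorm (fun x => szego a x * u) ≤ hardyNorm (szego a) * ‖u‖ := by
  have hs := isHardy_szego ha
  refine hardyNorm_le_of_meanSq_le (mul_nonneg (hardyNorm_nonneg _) (norm_nonneg _)) fun r hr => ?_
  have h1 : meanSq (fun x => szego a x * u) r = ‖u‖ ^ 2 * meanSq (szego a) r := by
    rw [meanSq, meanSq, ← average_const_mul_sphere]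
    simp only [norm_szego_mul, mul_pow, mul_comm]
  have h2 : sphereMean (szego a) r ≤ hardyNorm (szego a) :=
    le_ciSup hs.2 (⟨r, hr⟩ : Set.Ioo (0 : ℝ) 1)
  rw [h1, mul_pow, mul_comm, ← sphereMean_sq]
  exact mul_le_mul_of_nonneg_right (pow_le_pow_left₀ (Real.sqrt_nonneg _) h2 2) (sq_nonneg _)

/-- Joint continuity up to the closed ball gives uniform convergence in `x` as `b → a`, which
dominates the Hardy norm. -/
theorem tendsto_hardyNorm_szego_sub {a : Para m} (ha : a ∈ Metric.ball (0 : Para m) 1) (c : Cl m) :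
    Tendsto (fun b => hardyNorm fun x => szego b x * c - szego a x * c) (𝓝 a) (𝓝 0) := by
  have hcs : CompactSpace (Metric.closedBall (0 : Para m) 1) :=
    isCompact_iff_compactSpace.1 (isCompact_closedBall _ _)
  have hu : TendstoUniformly (fun (b : Para m) (x : Metric.closedBall (0 : Para m) 1) => szego b x)
      (fun x => szego a x) (𝓝 a) := by
    have hpair : Continuous fun p : Para m × Metric.closedBall (0 : Para m) 1 =>
        (p.1, (p.2 : Para m)) := by fun_prop
    have hc := continuousOn_szego.comp (hpair.continuousOn (s := Metric.ball 0 1 ×ˢ Set.univ))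
      fun p hp => ⟨hp.1, p.2.2⟩
    exact ContinuousOn.tendstoUniformly (Metric.isOpen_ball.mem_nhds ha) hc
  obtain ⟨K, hK, hKc⟩ := norm_mul_const_le c
  rw [Metric.tendsto_nhds]
  intro ε hε
  have hδ : 0 < ε / (2 * (K + 1)) := by positivity
  filter_upwards [Metric.tendstoUniformly_iff.1 hu _ hδ, Metric.isOpen_ball.mem_nhds ha]
    with b hb hbb
  have hH := ((isHardy_szego hbb).mul_const c).sub ((isHardy_szego ha).mul_const c)
  have : hardyNorm (fun x => szego b x * c - szego a x * c) ≤ K * (ε / (2 * (K + 1))) := by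
    refine hardyNorm_le_of_norm_le (by positivity) hH fun x hx => ?_
    rw [← sub_mul]
    refine (hKc _).trans (mul_le_mul_of_nonneg_left ?_ hK)
    have := hb ⟨x, Metric.ball_subset_closedBall hx⟩
    rw [dist_comm, dist_eq_norm] at this
    exact this.le
  rw [Real.dist_0_eq_abs, abs_of_nonneg (hardyNorm_nonneg _)]
  refine this.trans_lt ?_
  rw [mul_div_assoc', div_lt_iff₀ (by positivity)]
  nlinarith

/-- Along a common ray the Szegő kernels are powers of affine functions. -/
theorem szego_ray (η : Sph m) {s t : ℝ} (hs : s ∈ Set.Ioo (0 : ℝ) 1) (ht : t ∈ Set.Ioo (0 : ℝ) 1) :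
    szego (s • (η : Para m)) (t • (η : Para m)) = ((1 - s * t) ^ m)⁻¹ • (1 : Cl m) := by
  have hη : ‖(η : Para m)‖ = 1 := by simp
  have h1 : (toCl (s • (η : Para m))).conj * toCl (t • (η : Para m)) = (s * t) • (1 : Cl m) := by
    rw [toCl_smul, toCl_smul, conj_smul, smul_mul_smul_comm, conj_mul_toCl, hη]; simp
  have hpos : 0 < 1 - s * t := by nlinarith [hs.1, hs.2, ht.1, ht.2]
  have h2 : (1 : Cl m) - (s * t) • (1 : Cl m) = (1 - s * t) • (1 : Cl m) := by
    rw [sub_smul, one_smul]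
  have hn1 : ‖(1 : Cl m)‖ = 1 := by
    have := coord_empty_conj_mul (1 : Cl m) 1
    rw [real_inner_self_eq_norm_sq, conj_one, mul_one, coord_one] at this
    simp at this
    exact (pow_eq_one_iff_of_nonneg (norm_nonneg _) two_ne_zero).1 this.symm
  rw [szego, h1, h2, conj_smul, conj_one, norm_smul, hn1, mul_one, Real.norm_eq_abs,
    abs_of_pos hpos, smul_smul]
  congr 1
  field_simp
  ring

end

/-! ### Gram–Schmidt with possibly non-invertible `⟨B_i, B_i⟩`, and nondegeneracy on rays. -/

section

open Cl
variable {m : ℕ} {f g h G : Para m → Cl m} {B : ℕ → Para m → Cl m} {n : ℕ}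

theorem IsHardy.projTerm (hG : IsHardy G) (f : Para m → Cl m) : IsHardy (projTerm f G) :=
  hG.mul_const _

theorem IsHardy.normalized (hG : IsHardy G) : IsHardy (normalized G) := hG.smul _

theorem IsHardy.remainder (hg : IsHardy g) (hB : ∀ i ∈ Finset.Ico 1 n, IsHardy (B i)) :
    IsHardy (remainder g B n) :=
  hg.sub (IsHardy.sum _ fun i hi => (hB i hi).projTerm g)

/-- `h` is orthogonal to those of `B_1, …, B_{n-1}` for which `⟨B_i, B_i⟩` is invertible. -/
def IsOrth (B : ℕ → Para m → Cl m) (n : ℕ) (h : Para m → Cl m) : Prop :=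
  ∀ i ∈ Finset.Ico 1 n, IsUnit (hardyInner (B i) (B i)) → hardyInner h (B i) = 0

/-- Where `⟨B_i, B_i⟩` is not invertible, its `Ring.inverse` is `0` and the projection vanishes;
hence orthogonality to such `B_i` is never required. -/
theorem IsOrth.hardyInner_projTerm (hh : IsOrth B n h) (hhH : IsHardy h)
    (hB : ∀ i ∈ Finset.Ico 1 n, IsHardy (B i)) {i : ℕ} (hi : i ∈ Finset.Ico 1 n) :
    hardyInner h (projTerm g (B i)) = 0 := by
  have e := hardyInner_mul_right hhH (hB i hi)
    (Ring.inverse (hardyInner (B i) (B i)) * hardyInner g (B i))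
  refine e.trans ?_
  by_cases hu : IsUnit (hardyInner (B i) (B i))
  · rw [hh i hi hu, mul_zero]
  · rw [Ring.inverse_non_unit _ hu, zero_mul, conj_zero, zero_mul]

theorem IsOrth.hardyInner_remainder (hh : IsOrth B n h) (hhH : IsHardy h)
    (hB : ∀ i ∈ Finset.Ico 1 n, IsHardy (B i)) (hg : IsHardy g) :
    hardyInner h (remainder g B n) = hardyInner h g := by
  have hP : ∀ i ∈ Finset.Ico 1 n, IsHardy (CliffordTM.projTerm g (B i)) :=
    fun i hi => (hB i hi).projTerm g
  have hs : hardyInner h (fun x => ∑ i ∈ Finset.Ico 1 n, CliffordTM.projTerm g (B i) x) = 0 := by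
    refine hardyInner_eq_zero_symm (IsHardy.sum _ hP) hhH ?_
    rw [hardyInner_sum_left _ hP hhH]
    exact Finset.sum_eq_zero fun i hi => hardyInner_eq_zero_symm hhH (hP i hi)
      (hh.hardyInner_projTerm hhH hB hi)
  have e := hardyInner_sub_right hhH hg (IsHardy.sum _ hP)
  rw [hs, sub_zero] at e
  exact e

theorem IsOrth.mul_const (hh : IsOrth B n h) (hhH : IsHardy h)
    (hB : ∀ i ∈ Finset.Ico 1 n, IsHardy (B i)) (c : Cl m) : IsOrth B n fun x => h x * c :=
  fun i hi hu => by rw [hardyInner_mul_left hhH (hB i hi), hh i hi hu, zero_mul]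

theorem IsOrth.normalized (hh : IsOrth B n h) (hhH : IsHardy h)
    (hB : ∀ i ∈ Finset.Ico 1 n, IsHardy (B i)) : IsOrth B n (normalized h) :=
  fun i hi hu => by
    have := hardyInner_smul_left hhH (hB i hi) (hardyNorm h)⁻¹
    rw [hh i hi hu, smul_zero] at this
    exact this

/-- Those of `B_1, …, B_{n-1}` for which `⟨B_i, B_i⟩` is invertible are mutually orthogonal. -/
def IsOrthSystem (B : ℕ → Para m → Cl m) (n : ℕ) : Prop :=
  ∀ j ∈ Finset.Ico 1 n, IsOrth B j (B j)

theorem isOrth_remainder (hO : IsOrthSystem B n) (hB : ∀ i ∈ Finset.Ico 1 n, IsHardy (B i))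
    (hg : IsHardy g) : IsOrth B n (remainder g B n) := by
  intro j hj hu
  have hP : ∀ i ∈ Finset.Ico 1 n, IsHardy (projTerm g (B i)) := fun i hi => (hB i hi).projTerm g
  have e := hardyInner_sub_left hg (IsHardy.sum _ hP) (hB j hj)
  rw [hardyInner_sum_left _ hP (hB j hj), Finset.sum_eq_single j] at e
  · have e2 := hardyInner_mul_left (hB j hj) (hB j hj)
      (Ring.inverse (hardyInner (B j) (B j)) * hardyInner g (B j))
    rw [← mul_assoc, Ring.mul_inverse_cancel _ hu, one_mul] at e2
    exact e.trans (sub_eq_zero.2 e2.symm)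
  · intro i hi hij
    have e2 := hardyInner_mul_left (hB i hi) (hB j hj)
      (Ring.inverse (hardyInner (B i) (B i)) * hardyInner g (B i))
    refine e2.trans ?_
    by_cases hui : IsUnit (hardyInner (B i) (B i))
    · have : hardyInner (B i) (B j) = 0 := by
        rcases lt_or_gt_of_ne hij with hlt | hlt
        · refine hardyInner_eq_zero_symm (hB j hj) (hB i hi) (hO j hj i ?_ hui)
          exact Finset.mem_Ico.2 ⟨(Finset.mem_Ico.1 hi).1, hlt⟩
        · exact hO i hi j (Finset.mem_Ico.2 ⟨(Finset.mem_Ico.1 hj).1, hlt⟩) hu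
      rw [this, zero_mul]
    · rw [Ring.inverse_non_unit _ hui, zero_mul, mul_zero]
  · exact fun h => absurd hj h

theorem eq_zero_of_forall_reInner (hf : IsHardy f) (hg : IsHardy g)
    (h : ∀ c, reInner f (fun x => g x * c) = 0) : hardyInner f g = 0 := by
  have := h (hardyInner f g)
  rw [reInner_mul_right hf hg] at this
  exact inner_self_eq_zero.1 this

/-- For a new parameter this is Gram–Schmidt. For a repeated one, the approximating functions are
orthogonal to `B_i`, and Cauchy–Schwarz carries this to their limit. -/
theorem IsTMNext.isOrth {a : ℕ → Para m} {b w : Para m} (hG : IsTMNext a B n b w G)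
    (hb : b ∈ Metric.ball (0 : Para m) 1) (hO : IsOrthSystem B n)
    (hB : ∀ i ∈ Finset.Ico 1 n, IsHardy (B i)) : IsOrth B n G := by
  have hN : ∀ b ∈ Metric.ball (0 : Para m) 1, IsHardy (normalized (remainder (szego b) B n)) ∧
      IsOrth B n (normalized (remainder (szego b) B n)) := fun b hb =>
    ⟨((isHardy_szego hb).remainder hB).normalized,
      (isOrth_remainder hO hB (isHardy_szego hb)).normalized ((isHardy_szego hb).remainder hB) hB⟩
  intro i hi hu
  by_cases hnew : ∀ i ∈ Finset.Ico 1 n, a i ≠ b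
  · rw [hardyInner_congr_left (hG.of_new hnew)]
    exact (hN b hb).2 i hi hu
  push Not at hnew
  have hlim := hG.of_repeated hnew
  have hball : ∀ᶠ ρ in 𝓝[>] (0 : ℝ), b + ρ • w ∈ Metric.ball (0 : Para m) 1 := by
    have hc : Continuous fun ρ : ℝ => b + ρ • w := by fun_prop
    have : Tendsto (fun ρ : ℝ => b + ρ • w) (𝓝[>] 0) (𝓝 b) := by
      have := hc.tendsto 0
      simp only [zero_smul, add_zero] at this
      exact this.mono_left nhdsWithin_le_nhds
    exact this.eventually (Metric.isOpen_ball.mem_nhds hb)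
  refine eq_zero_of_forall_reInner hG.isHardy (hB i hi) fun c => ?_
  have hBc := (hB i hi).mul_const c
  have hle : ∀ᶠ ρ in 𝓝[>] (0 : ℝ), |reInner G (fun x => B i x * c)| ≤
      hardyNorm (fun x => normalized (remainder (szego (b + ρ • w)) B n) x - G x)
        * hardyNorm (fun x => B i x * c) := by
    filter_upwards [hball] with ρ hρ
    obtain ⟨h1, h2⟩ := hN _ hρ
    have e := reInner_sub_left h1 hG.isHardy hBc
    rw [reInner_mul_right h1 (hB i hi), h2 i hi hu, inner_zero_right, zero_sub] at e
    rw [← abs_neg, ← e]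
    exact abs_reInner_le (h1.sub hG.isHardy) hBc
  have h0 := ge_of_tendsto (hlim.mul_const _) hle
  rw [zero_mul] at h0
  exact abs_eq_zero.1 (le_antisymm h0 (abs_nonneg _))

section Step

variable (hO : IsOrthSystem B n) (hB : ∀ i ∈ Finset.Ico 1 n, IsHardy (B i))
include hO hB

theorem hardyNorm_remainder_sq (hf : IsHardy f) :
    hardyNorm (remainder f B n) ^ 2 = reInner (remainder f B n) f := by
  have hR := hf.remainder hB
  rw [← reInner_self hR, reInner, (isOrth_remainder hO hB hf).hardyInner_remainder hR hB hf]
  rfl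

theorem hardyNorm_remainder_mul_le (hg : IsHardy g) (u : Cl m) :
    hardyNorm (fun x => remainder g B n x * u) ≤ hardyNorm (fun x => g x * u) := by
  have hR := hg.remainder hB
  have hRu := hR.mul_const u
  have h : hardyNorm (fun x => remainder g B n x * u) ^ 2
      = reInner (fun x => remainder g B n x * u) (fun x => g x * u) := by
    rw [← reInner_self hRu, reInner_mul_right hRu hR, reInner_mul_right hRu hg,
      ((isOrth_remainder hO hB hg).mul_const hR hB u).hardyInner_remainder hRu hB hg]
  have h2 := (le_abs_self _).trans (abs_reInner_le hRu (hg.mul_const u))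
  rw [← h, sq] at h2
  rcases (hardyNorm_nonneg fun x => remainder g B n x * u).eq_or_lt with h0 | h0
  · rw [← h0]; exact hardyNorm_nonneg _
  · exact le_of_mul_le_mul_left h2 h0

/-- The gain of a new parameter `b` dominates the pairing of the remainder with `S_b`. -/
theorem reInner_remainder_le (hf : IsHardy f) (hg : IsHardy g)
    (hu : IsUnit (hardyInner (normalized (remainder g B n)) (normalized (remainder g B n))))
    (c : Cl m) :
    reInner (remainder f B n) (fun x => g x * c) ≤
      hardyNorm (projTerm f (normalized (remainder g B n))) * hardyNorm (fun x => g x * c) := by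
  set T := remainder g B n
  have hT : IsHardy T := hg.remainder hB
  have hG : IsHardy (normalized T) := hT.normalized
  have hR := hf.remainder hB
  have hP := hG.projTerm f
  -- The projection is self-adjoint, so it can be moved from `f` to `g`.
  have e1 : hardyInner (remainder f B n) g = hardyInner f T := by
    rw [← (isOrth_remainder hO hB hf).hardyInner_remainder hR hB hg, ← conj_hardyInner hT hf,
      ← (isOrth_remainder hO hB hg).hardyInner_remainder hT hB hf, conj_hardyInner hT hR]
  have e2 : hardyInner (projTerm f (normalized T)) (normalized T)
      = hardyInner f (normalized T) := by
    have := hardyInner_mul_left hG hG (Ring.inverse (hardyInner (normalized T) (normalized T))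
      * hardyInner f (normalized T))
    rw [← mul_assoc, Ring.mul_inverse_cancel _ hu, one_mul] at this
    exact this
  have hs : ∀ {F : Para m → Cl m}, IsHardy F →
      hardyInner F (normalized T) = (hardyNorm T)⁻¹ • hardyInner F T :=
    fun hF => hardyInner_smul_right hF hT _
  -- If `‖T‖` were `0`, the convention `0⁻¹ = 0` would make the Gram element `0`, which is not a
  -- unit.
  have hne : (hardyNorm T)⁻¹ ≠ 0 := by
    intro h0
    rw [hs hG, h0, zero_smul] at hu
    exact not_isUnit_zero hu
  have e3 : hardyInner (projTerm f (normalized T)) T = hardyInner f T := by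
    rw [hs hP, hs hf] at e2
    exact smul_right_injective _ hne e2
  -- `f` and its projection have the same product with `T`; Cauchy–Schwarz then involves `‖T c‖`,
  -- which is at most `‖g c‖`.
  rw [reInner_mul_right hR hg, e1, ← e3, ← reInner_mul_right hP hT]
  refine (le_abs_self _).trans ((abs_reInner_le hP (hT.mul_const c)).trans ?_)
  exact mul_le_mul_of_nonneg_left (hardyNorm_remainder_mul_le hO hB hg c) (hardyNorm_nonneg _)

end Step

/-- A non-unit has a nonzero right annihilator `c`, and then `‖G c‖²` is the scalar part of `conj c
* ⟨G, G⟩ * c = 0`. -/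
theorem exists_null_of_not_isUnit {T : Para m → Cl m} (hT : IsHardy T)
    (hu : ¬ IsUnit (hardyInner (normalized T) (normalized T))) :
    ∃ c : Cl m, c ≠ 0 ∧ hardyNorm (fun x => T x * c) = 0 := by
  have hG := hT.normalized
  by_cases h0 : hardyNorm T = 0
  · exact ⟨1, one_ne_zero, by simpa using h0⟩
  obtain ⟨c, hc, hc0⟩ : ∃ c, hardyInner (normalized T) (normalized T) * c = 0 ∧ c ≠ 0 := by
    by_contra! h
    exact hu (isUnit_of_injective h)
  refine ⟨c, hc0, ?_⟩
  have h1 : hardyNorm (fun x => normalized T x * c) ^ 2 = 0 := by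
    rw [← reInner_self (hG.mul_const c), reInner_mul_right (hG.mul_const c) hG,
      hardyInner_mul_left hG hG, hc, inner_zero_right]
  have h2 : hardyNorm (fun x => normalized T x * c)
      = |(hardyNorm T)⁻¹| * hardyNorm (fun x => T x * c) := by
    rw [← hardyNorm_smul (hT.mul_const c)]
    simp only [normalized, smul_mul_assoc]
  have h3 : |(hardyNorm T)⁻¹| ≠ 0 := abs_ne_zero.2 (inv_ne_zero h0)
  rw [h2] at h1
  exact (mul_eq_zero.1 (pow_eq_zero_iff two_ne_zero |>.1 h1)).resolve_left h3

-- The functions `(1 - t_j r)^{-m}` have distinct poles, hence are independent; `1 ≤ m` ensures that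
-- there are poles. Clearing denominators gives a polynomial with infinitely many roots.
open Polynomial in
theorem real_coeff_eq_zero_of_ray (hm : 1 ≤ m) {ι : Type*} [Fintype ι] [DecidableEq ι] {t : ι → ℝ}
    (ht : ∀ j, t j ∈ Set.Ioo (0 : ℝ) 1) (hinj : Function.Injective t) {y : ι → ℝ}
    (h : ∀ r ∈ Set.Ioo (0 : ℝ) 1, ∑ j, ((1 - t j * r) ^ m)⁻¹ * y j = 0) (j : ι) : y j = 0 := by
  set P : ℝ[X] := ∑ j, C (y j) * ∏ l ∈ Finset.univ.erase j, (1 - C (t l) * X) ^ m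
  have hev : ∀ r, P.eval r = ∑ j, y j * ∏ l ∈ Finset.univ.erase j, (1 - t l * r) ^ m := by
    intro r
    simp [P, eval_finsetSum, eval_prod]
  have hroot : ∀ r ∈ Set.Ioo (0 : ℝ) 1, P.IsRoot r := by
    intro r hr
    have hne : ∀ l, (1 - t l * r) ^ m ≠ 0 := fun l => by
      have : 0 < 1 - t l * r := by nlinarith [(ht l).1, (ht l).2, hr.1, hr.2]
      positivity
    have e : P.eval r = (∏ l, (1 - t l * r) ^ m) * ∑ j, ((1 - t j * r) ^ m)⁻¹ * y j := by
      rw [hev, Finset.mul_sum]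
      refine Finset.sum_congr rfl fun j _ => ?_
      rw [← Finset.mul_prod_erase Finset.univ _ (Finset.mem_univ j)]
      rw [mul_mul_mul_comm, mul_inv_cancel₀ (hne j), one_mul, mul_comm]
    rw [IsRoot.def, e, h r hr, mul_zero]
  have hP : P = 0 := eq_zero_of_infinite_isRoot P ((Set.Ioo_infinite one_pos).mono hroot)
  -- At the pole `1 / t_j`, outside the interval, every term but the `j`-th vanishes.
  have h1 := hev (t j)⁻¹
  have htj : t j ≠ 0 := (ht j).1.ne'
  rw [hP, eval_zero, Finset.sum_eq_single j] at h1
  · refine (mul_eq_zero.1 h1.symm).resolve_right (Finset.prod_ne_zero_iff.2 fun l hl => ?_)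
    refine pow_ne_zero _ fun h0 => (Finset.mem_erase.1 hl).1 (hinj ?_)
    field_simp at h0
    linarith
  · intro l _ hl
    refine mul_eq_zero_of_right _ (Finset.prod_eq_zero (Finset.mem_erase.2 ⟨hl.symm,
      Finset.mem_univ j⟩) ?_)
    rw [mul_inv_cancel₀ htj, sub_self, zero_pow (by omega)]
  · simp

/-- At a degenerate `t`, the function `r ↦ (1 - t r)^{-m} c` on the ray is a combination of `B_1, …,
B_{n-1}` with right Clifford coefficients. These coefficients range over a finite-dimensional space,
whereas distinct `t` give independent functions. -/
theorem finite_null_on_ray (hm : 1 ≤ m) (hB : ∀ i ∈ Finset.Ico 1 n, IsHardy (B i)) (η : Sph m) :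
    {t : ℝ | t ∈ Set.Ioo (0 : ℝ) 1 ∧ ∃ c : Cl m, c ≠ 0 ∧
      hardyNorm (fun x => remainder (szego (t • (η : Para m))) B n x * c) = 0}.Finite := by
  by_contra hinf
  let τ := Set.Infinite.natEmbedding _ hinf
  let k := Module.finrank ℝ (Finset.Ico 1 n → Cl m)
  let t : Fin (k + 1) → ℝ := fun j => τ j
  have ht : ∀ j, t j ∈ Set.Ioo (0 : ℝ) 1 := fun j => (τ j).2.1
  have hinj : Function.Injective t := fun i j hij =>
    Fin.ext (τ.injective (Subtype.ext hij))
  choose c hc0 hc using fun j : Fin (k + 1) => (τ j).2.2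
  let d : Fin (k + 1) → (Finset.Ico 1 n → Cl m) := fun j i =>
    Ring.inverse (hardyInner (B i) (B i)) * hardyInner (szego (t j • (η : Para m))) (B i) * c j
  -- There are `k + 1` coefficient vectors in a space of dimension `k`, so some real combination of
  -- them vanishes.
  obtain ⟨α, hα, j₀, hj₀⟩ : ∃ α : Fin (k + 1) → ℝ, ∑ j, α j • d j = 0 ∧ ∃ j, α j ≠ 0 := by
    refine Fintype.not_linearIndependent_iff.1 fun hli => ?_
    have := hli.fintype_card_le_finrank
    rw [Fintype.card_fin] at this
    omega
  have hzero : ∀ r ∈ Set.Ioo (0 : ℝ) 1, ∀ j,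
      ((1 - t j * r) ^ m)⁻¹ • c j = ∑ i : Finset.Ico 1 n, B i (r • (η : Para m)) * d j i := by
    intro r hr j
    have hS := isHardy_szego (smul_mem_ball (ht j) η)
    have h0 := eq_zero_of_hardyNorm_eq_zero ((hS.remainder hB).mul_const (c j)) (hc j) hr η
    have e : remainder (szego (t j • (η : Para m))) B n (r • (η : Para m))
        = ((1 - t j * r) ^ m)⁻¹ • (1 : Cl m) - ∑ i ∈ Finset.Ico 1 n,
          projTerm (szego (t j • (η : Para m))) (B i) (r • (η : Para m)) := by
      rw [← szego_ray η (ht j) hr]; rfl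
    rw [e, sub_mul, smul_mul_assoc, one_mul, sub_eq_zero, Finset.sum_mul] at h0
    rw [h0, ← Finset.sum_coe_sort]
    refine Finset.sum_congr rfl fun i _ => ?_
    simp only [projTerm, d, mul_assoc]
  have hsum : ∀ r ∈ Set.Ioo (0 : ℝ) 1, ∑ j, ((1 - t j * r) ^ m)⁻¹ • (α j • c j) = 0 := by
    intro r hr
    have e1 : ∀ j, ((1 - t j * r) ^ m)⁻¹ • (α j • c j)
        = ∑ i : Finset.Ico 1 n, B i (r • (η : Para m)) * (α j • d j i) := fun j => by
      rw [smul_comm, hzero r hr j, Finset.smul_sum]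
      simp only [mul_smul_comm]
    simp only [e1]
    rw [Finset.sum_comm]
    refine Finset.sum_eq_zero fun i _ => ?_
    rw [← Finset.mul_sum]
    have := congrFun hα i
    simp only [Finset.sum_apply, Pi.smul_apply, Pi.zero_apply] at this
    rw [this, mul_zero]
  have hall : ∀ T, (α j₀ • c j₀).coord T = 0 := by
    intro T
    refine real_coeff_eq_zero_of_ray hm ht hinj (y := fun j => (α j • c j).coord T) ?_ j₀
    intro r hr
    have := congrArg (coordL T) (hsum r hr)
    rw [map_sum, map_zero] at this
    exact this
  have : α j₀ • c j₀ = 0 := ext hall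
  exact (smul_ne_zero hj₀ (hc0 j₀)) this

end

/-! ### The maximum selection principle and the greedy recursion. -/

section

open Cl
variable {m : ℕ} {f g h G : Para m → Cl m} {a ω : ℕ → Para m} {B : ℕ → Para m → Cl m} {n : ℕ}

theorem IsAdaptiveTM.isHardy (hB : IsAdaptiveTM f a ω B) {i : ℕ} (hi : i ∈ Finset.Ico 1 n) :
    IsHardy (B i) := (hB.next i (Finset.mem_Ico.1 hi).1).isHardy

theorem IsAdaptiveTM.isOrthSystem (hB : IsAdaptiveTM f a ω B) (n : ℕ) : IsOrthSystem B n := by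
  induction n with
  | zero => intro j hj; simp at hj
  | succ n ih =>
    intro j hj
    rw [Finset.mem_Ico] at hj
    rcases (Nat.lt_succ_iff.1 hj.2).lt_or_eq with h | h
    · exact ih j (Finset.mem_Ico.2 ⟨hj.1, h⟩)
    · subst h
      exact (hB.next j hj.1).isOrth (hB.mem_ball j hj.1) ih fun i hi => hB.isHardy hi

/-- The maximum selection principle, compared with the choice of the parameter `b`. -/
theorem IsAdaptiveTM.reInner_le_of_isUnit (hB : IsAdaptiveTM f a ω B) (hf : IsHardy f)
    (hn : 1 ≤ n) {b : Para m} (hb : b ∈ Metric.ball (0 : Para m) 1)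
    (hnew : ∀ i ∈ Finset.Ico 1 n, a i ≠ b)
    (hu : IsUnit (hardyInner (normalized (remainder (szego b) B n))
      (normalized (remainder (szego b) B n)))) (c : Cl m) :
    reInner (remainder f B n) (fun x => szego b x * c) ≤
      hardyNorm (projTerm f (B n)) * (hardyNorm (szego b) * ‖c‖) := by
  have hBH : ∀ i ∈ Finset.Ico 1 n, IsHardy (B i) := fun i hi => hB.isHardy hi
  refine (reInner_remainder_le (hB.isOrthSystem n) hBH hf (isHardy_szego hb) hu c).trans ?_
  refine mul_le_mul ?_ (hardyNorm_szego_mul_le hb c) (hardyNorm_nonneg _) (hardyNorm_nonneg _)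
  -- The direction plays no role for a new parameter; `ω n` merely supplies some unit vector.
  refine hB.maximal n hn b hb (ω n) (hB.mem_sphere n hn) _
    ⟨((isHardy_szego hb).remainder hBH).normalized, fun _ _ _ => rfl, ?_⟩
  rintro ⟨i, hi, hib⟩
  exact absurd hib (hnew i hi)

theorem exists_ray (b : Para m) : ∃ η : Sph m, b = ‖b‖ • (η : Para m) := by
  by_cases hb : b = 0
  · exact ⟨⟨ev 0, by simp⟩, by simp [hb]⟩
  · refine ⟨⟨‖b‖⁻¹ • b, by simp [norm_smul, hb]⟩, ?_⟩
    have : ‖b‖ ≠ 0 := norm_ne_zero_iff.2 hb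
    simp [smul_smul, this]

theorem eventually_notMem_nhdsGT_of_finite {F : Set ℝ} (hF : F.Finite) (s : ℝ) :
    ∀ᶠ t in 𝓝[>] s, t ∉ F := by
  have h1 : (F \ {s})ᶜ ∈ 𝓝 s :=
    (hF.subset Set.sdiff_subset).isClosed.isOpen_compl.mem_nhds (by simp)
  filter_upwards [mem_nhdsWithin_of_mem_nhds h1, self_mem_nhdsWithin] with t ht hst htF
  exact ht ⟨htF, fun h => (ne_of_gt (show s < t from hst)) h⟩

/-- Here `b` may repeat some `a_i` or have a degenerate Gram element. The bound is taken at `t η`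
with `t ↓ ‖b‖`, and both sides converge because `S_b` depends continuously on `b`. -/
theorem IsAdaptiveTM.reInner_le (hm : 1 ≤ m) (hB : IsAdaptiveTM f a ω B) (hf : IsHardy f)
    (hn : 1 ≤ n) {b : Para m} (hb : b ∈ Metric.ball (0 : Para m) 1) (c : Cl m) :
    reInner (remainder f B n) (fun x => szego b x * c) ≤
      hardyNorm (projTerm f (B n)) * (hardyNorm (szego b) * ‖c‖) := by
  have hBH : ∀ i ∈ Finset.Ico 1 n, IsHardy (B i) := fun i hi => hB.isHardy hi
  have hR := hf.remainder hBH
  obtain ⟨η, hη⟩ := exists_ray b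
  have hη1 : ‖(η : Para m)‖ = 1 := by simp
  have hs1 : ‖b‖ < 1 := by rwa [mem_ball_zero_iff] at hb
  set D := hardyNorm (projTerm f (B n))
  have hD : 0 ≤ D := hardyNorm_nonneg _
  have hray : Tendsto (fun t : ℝ => t • (η : Para m)) (𝓝[>] ‖b‖) (𝓝 b) := by
    have hc : Continuous fun t : ℝ => t • (η : Para m) := by fun_prop
    have := hc.tendsto ‖b‖
    rw [← hη] at this
    exact this.mono_left nhdsWithin_le_nhds
  have hfin : {t : ℝ | ∃ i ∈ Finset.Ico 1 n, t = ‖a i‖}.Finite := by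
    have := ((Finset.Ico 1 n).image fun i => ‖a i‖).finite_toSet
    refine this.subset ?_
    rintro t ⟨i, hi, rfl⟩
    simp only [Finset.coe_image, Set.mem_image]
    exact ⟨i, hi, rfl⟩
  have h1 := (tendsto_hardyNorm_szego_sub hb c).comp hray
  have h2 := (tendsto_hardyNorm_szego_sub hb 1).comp hray
  have hlim : Tendsto (fun t : ℝ => D * ((hardyNorm (szego b) +
      hardyNorm fun x => szego (t • (η : Para m)) x * 1 - szego b x * 1) * ‖c‖)
      + hardyNorm (remainder f B n) *
        hardyNorm fun x => szego (t • (η : Para m)) x * c - szego b x * c)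
      (𝓝[>] ‖b‖) (𝓝 (D * ((hardyNorm (szego b) + 0) * ‖c‖) + hardyNorm (remainder f B n) * 0)) :=
    (((h2.const_add _).mul_const _).const_mul _).add (h1.const_mul _)
  rw [mul_zero, add_zero, add_zero] at hlim
  refine ge_of_tendsto hlim ?_
  -- Such `t` are in `(0, 1)`, even for `b = 0` because the approach is from above. They also avoid
  -- the norms of the old parameters and the degenerate values.
  filter_upwards [Ioo_mem_nhdsGT hs1, eventually_notMem_nhdsGT_of_finite hfin ‖b‖,
    eventually_notMem_nhdsGT_of_finite (finite_null_on_ray hm hBH η) ‖b‖] with t ht hta htu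
  have ht01 : t ∈ Set.Ioo (0 : ℝ) 1 := ⟨(norm_nonneg b).trans_lt ht.1, ht.2⟩
  have htb := smul_mem_ball ht01 η
  have hS := isHardy_szego htb
  have hSb := isHardy_szego hb
  have hnew : ∀ i ∈ Finset.Ico 1 n, a i ≠ t • (η : Para m) := by
    intro i hi hai
    refine hta ⟨i, hi, ?_⟩
    rw [hai, norm_smul, hη1, mul_one, Real.norm_eq_abs, abs_of_pos ht01.1]
  have hu : IsUnit (hardyInner (normalized (remainder (szego (t • (η : Para m))) B n))
      (normalized (remainder (szego (t • (η : Para m))) B n))) := by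
    by_contra hu
    exact htu ⟨ht01, exists_null_of_not_isUnit (hS.remainder hBH) hu⟩
  have key := hB.reInner_le_of_isUnit hf hn htb hnew hu c
  have hsub := reInner_sub_right hR (hS.mul_const c) (hSb.mul_const c)
  have hcs := abs_le.1 (abs_reInner_le hR ((hS.mul_const c).sub (hSb.mul_const c)))
  have hnorm : hardyNorm (szego (t • (η : Para m))) ≤ hardyNorm (szego b) +
      hardyNorm fun x => szego (t • (η : Para m)) x * 1 - szego b x * 1 := by
    have := hardyNorm_add_le hSb ((hS.mul_const 1).sub (hSb.mul_const 1))
    simpa only [mul_one, add_sub_cancel] using this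
  have h3 : D * (hardyNorm (szego (t • (η : Para m))) * ‖c‖) ≤ D * ((hardyNorm (szego b) +
      hardyNorm fun x => szego (t • (η : Para m)) x * 1 - szego b x * 1) * ‖c‖) := by gcongr
  linarith [hcs.1]

theorem IsAdaptiveTM.reInner_normalized_le (hm : 1 ≤ m) (hB : IsAdaptiveTM f a ω B)
    (hf : IsHardy f) (hn : 1 ≤ n) {b : Para m} (hb : b ∈ Metric.ball (0 : Para m) 1) (c : Cl m) :
    reInner (remainder f B n) (fun x => normalized (szego b) x * c) ≤
      hardyNorm (projTerm f (B n)) * ‖c‖ := by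
  have hR : IsHardy (remainder f B n) := hf.remainder fun i hi => hB.isHardy hi
  have hS := (isHardy_szego hb).mul_const c
  have e : reInner (remainder f B n) (fun x => normalized (szego b) x * c)
      = (hardyNorm (szego b))⁻¹ * reInner (remainder f B n) (fun x => szego b x * c) := by
    have := reInner_smul_left hS hR (hardyNorm (szego b))⁻¹
    rw [reInner_comm hS hR, reInner_comm (hS.smul _) hR] at this
    simpa only [normalized, smul_mul_assoc] using this
  rw [e]
  refine (mul_le_mul_of_nonneg_left (hB.reInner_le hm hf hn hb c)
    (inv_nonneg.2 (hardyNorm_nonneg _))).trans ?_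
  -- An inequality is enough, so `‖S_b‖ = 0` needs no exclusion: the inverse is then `0`.
  have h1 : (hardyNorm (szego b))⁻¹ * hardyNorm (szego b) ≤ 1 := by
    by_cases h0 : hardyNorm (szego b) = 0
    · simp [h0]
    · exact (inv_mul_cancel₀ h0).le
  have h2 : 0 ≤ hardyNorm (projTerm f (B n)) * ‖c‖ :=
    mul_nonneg (hardyNorm_nonneg _) (norm_nonneg _)
  nlinarith

/-- `‖f_n‖² = Re⟨f_n, f⟩`, and `f` is approximated by partial sums of its atomic expansion. Each
atom contributes at most `‖P_{B_n} f‖ |c_k|`, and the error of the partial sum is absorbed by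
Cauchy–Schwarz. -/
theorem IsAdaptiveTM.hardyNorm_remainder_sq_le (hm : 1 ≤ m) (hB : IsAdaptiveTM f a ω B) {M : ℝ}
    (hf : IsHardyClass M f) (hn : 1 ≤ n) :
    hardyNorm (remainder f B n) ^ 2 ≤ M * hardyNorm (projTerm f (B n)) := by
  obtain ⟨hfH, b, c, hb, hc, hcM, hlim⟩ := hf
  have hBH : ∀ i ∈ Finset.Ico 1 n, IsHardy (B i) := fun i hi => hB.isHardy hi
  have hR := hfH.remainder hBH
  set D := hardyNorm (projTerm f (B n))
  have hD : 0 ≤ D := hardyNorm_nonneg _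
  have hterm : ∀ k, IsHardy fun x => normalized (szego (b k)) x * c k := fun k =>
    (isHardy_szego (hb k)).normalized.mul_const _
  rw [hardyNorm_remainder_sq (hB.isOrthSystem n) hBH hfH]
  have hlim2 := (hlim.const_mul (hardyNorm (remainder f B n))).const_add (M * D)
  rw [mul_zero, add_zero] at hlim2
  refine ge_of_tendsto hlim2 (Eventually.of_forall fun K => ?_)
  have hSH : IsHardy fun x => ∑ k ∈ Finset.range K, normalized (szego (b k)) x * c k :=
    IsHardy.sum _ fun k _ => hterm k
  have hsub := reInner_sub_right hR hfH hSH
  have hcs := (le_abs_self _).trans (abs_reInner_le hR (hfH.sub hSH))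
  have hsum : reInner (remainder f B n)
      (fun x => ∑ k ∈ Finset.range K, normalized (szego (b k)) x * c k) ≤ M * D := by
    have e : reInner (remainder f B n)
        (fun x => ∑ k ∈ Finset.range K, normalized (szego (b k)) x * c k)
        = ∑ k ∈ Finset.range K, reInner (remainder f B n)
          (fun x => normalized (szego (b k)) x * c k) := by
      rw [reInner_comm hR hSH, reInner, hardyInner_sum_left _ (fun k _ => hterm k) hR,
        ← coordL_apply, map_sum]
      exact Finset.sum_congr rfl fun k _ => reInner_comm (hterm k) hR
    rw [e]
    calc _ ≤ ∑ k ∈ Finset.range K, D * ‖c k‖ :=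
          Finset.sum_le_sum fun k _ => hB.reInner_normalized_le hm hfH hn (hb k) (c k)
      _ = D * ∑ k ∈ Finset.range K, ‖c k‖ := (Finset.mul_sum _ _ _).symm
      _ ≤ D * M := mul_le_mul_of_nonneg_left
          ((hc.sum_le_tsum _ fun k _ => norm_nonneg _).trans hcM) hD
      _ = M * D := mul_comm _ _
  linarith

/-- Pythagoras: `f_{n+1}` is orthogonal to `P_{B_n} f`. -/
theorem IsAdaptiveTM.hardyNorm_remainder_succ (hB : IsAdaptiveTM f a ω B) (hf : IsHardy f)
    (hn : 1 ≤ n) : hardyNorm (remainder f B n) ^ 2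
      = hardyNorm (remainder f B (n + 1)) ^ 2 + hardyNorm (projTerm f (B n)) ^ 2 := by
  have hBH : ∀ i ∈ Finset.Ico 1 (n + 1), IsHardy (B i) := fun i hi => hB.isHardy hi
  have hR := hf.remainder hBH
  have hmem : n ∈ Finset.Ico 1 (n + 1) := Finset.mem_Ico.2 ⟨hn, n.lt_succ_self⟩
  have hP := (hBH n hmem).projTerm f
  have e : remainder f B n = fun x => remainder f B (n + 1) x + projTerm f (B n) x := by
    funext x
    simp only [remainder, Finset.sum_Ico_succ_top hn]
    abel
  have h0 : reInner (remainder f B (n + 1)) (projTerm f (B n)) = 0 := by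
    rw [reInner, (isOrth_remainder (hB.isOrthSystem _) hBH hf).hardyInner_projTerm hR hBH hmem]
    rfl
  rw [e, hardyNorm_add_sq hR hP, h0]
  ring

/-- The decay of a sequence `A_{n+1} = A_n - d_n²` with `A_n ≤ M d_n`. -/
theorem nat_mul_le_sq_of_greedy {A d : ℕ → ℝ} {M : ℝ} (hA : ∀ n, 0 ≤ A n)
    (h1 : ∀ n, 1 ≤ n → A n ≤ M * d n) (h2 : ∀ n, 1 ≤ n → A n = A (n + 1) + d n ^ 2)
    {N : ℕ} (hN : 1 ≤ N) : N * A N ≤ M ^ 2 := by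
  -- Multiply the recursion by `M²` and use `A n ≤ M * d n` squared; this form avoids dividing by
  -- `M`, which may be `0`.
  have hrec : ∀ n, 1 ≤ n → A n ^ 2 + M ^ 2 * A (n + 1) ≤ M ^ 2 * A n := by
    intro n hn
    have h3 : A n ^ 2 ≤ (M * d n) ^ 2 := pow_le_pow_left₀ (hA n) (h1 n hn) 2
    have h4 := congrArg (fun z => M ^ 2 * z) (h2 n hn)
    nlinarith
  have hle : ∀ n, 1 ≤ n → A n ≤ M ^ 2 := by
    intro n hn
    have h3 := hrec n hn
    have h4 : 0 ≤ M ^ 2 * A (n + 1) := mul_nonneg (sq_nonneg _) (hA _)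
    rcases (hA n).eq_or_lt with h0 | h0
    · rw [← h0]; exact sq_nonneg _
    · nlinarith
  induction N, hN using Nat.le_induction with
  | base => simpa using hle 1 le_rfl
  | succ n hn ih =>
    have h3 := hrec n hn
    have hn0 : (0 : ℝ) < n := by exact_mod_cast hn
    push_cast
    rcases (hA n).eq_or_lt with h0 | h0
    · have : A (n + 1) ≤ 0 := by nlinarith [h2 n hn, sq_nonneg (d n)]
      have h5 := hA (n + 1)
      have : A (n + 1) = 0 := le_antisymm this h5
      rw [this, mul_zero]
      exact sq_nonneg _
    · have hM2 : 0 < M ^ 2 := h0.trans_le (hle n hn)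
      refine le_of_mul_le_mul_left ?_ hM2
      -- With `t = A n / M²`, the claim `(n+1) t (1 - t) ≤ 1` follows from `1 - (n+1) t (1 - t) = (1
      -- - n t)(1 - t) + t²`, where `n t ≤ 1` and `t ≤ 1`.
      nlinarith [sq_nonneg (M ^ 2 - n * A n), mul_nonneg (sub_nonneg.2 ih) (hA n),
        mul_nonneg (sub_nonneg.2 ih) (sub_nonneg.2 (hle n hn)),
        mul_le_mul_of_nonneg_left h3 (by positivity : (0 : ℝ) ≤ n + 1)]

end

end CliffordTM

end

theorem theorem5p3 (m : ℕ) (hm : 1 ≤ m) (M : ℝ) (f : Para m → Cl m) (hf : IsHardyClass M f)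
    (a ω : ℕ → Para m) (B : ℕ → Para m → Cl m) (hB : IsAdaptiveTM f a ω B)
    (N : ℕ) (hN : 1 ≤ N) :
    hardyNorm (remainder f B N) ≤ (2 : ℝ) ^ ((m : ℝ) / 2) * M / √(N : ℝ) := by
  have hM : 0 ≤ M := by
    obtain ⟨_, b, c, _, _, hcM, _⟩ := hf
    exact (tsum_nonneg fun k => norm_nonneg (c k)).trans hcM
  have hN0 : (0 : ℝ) < N := by exact_mod_cast hN
  have h := nat_mul_le_sq_of_greedy (A := fun n => hardyNorm (remainder f B n) ^ 2)
    (d := fun n => hardyNorm (projTerm f (B n))) (fun n => sq_nonneg _)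
    (fun n hn => hB.hardyNorm_remainder_sq_le hm hf hn)
    (fun n hn => hB.hardyNorm_remainder_succ hf.1 hn) hN
  have h1 : √(N : ℝ) * hardyNorm (remainder f B N) ≤ M := by
    refine le_of_sq_le_sq ?_ hM
    rw [mul_pow, Real.sq_sqrt hN0.le]
    exact h
  -- The bound is already proved with constant `1`; the stated factor only weakens it.
  have h2 : (1 : ℝ) ≤ 2 ^ ((m : ℝ) / 2) := Real.one_le_rpow (by norm_num) (by positivity)
  rw [le_div_iff₀ (Real.sqrt_pos.2 hN0)]
  nlinarith
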